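/- **Setting.** Let $\mathbb K\in\{\mathbb R,\mathbb C\}$. Let $G_A$ be an involutive Banach–Lie group over $\mathbb K$, i.e. a Banach–Lie group over $\mathbb K$ with a (real-)diffeomorphism $u\mapsto u^*$ satisfying $(uv)^*=v^*u^*$ and $(u^*)^*=u$; write $u^{-*}:=(u^{-1})^*$. Let $G_B$ be a Banach–Lie subgroup of $G_A$ (a subgroup that is a split submanifold) with $u^*\in G_B$ whenever $u\in G_B$. Let $\mathcal H_A$ be a complex Hilbert space, $\mathcal H_B\subseteq\mathcal H_A$ a closed subspace, $P\colon\mathcal H_A\to\mathcal H_B$ the orthogonal projection, and $\pi_A\colon G_A\to\mathcal B(\mathcal H_A)$ a norm-continuous (if $\mathbb K=\mathbb C$: holomorphic) representation with $\pi_A(u^*)=\pi_A(u)^*$ for $u\in G_A$ and $\pi_A(w)\mathcal H_B\subseteq\mathcal H_B$ for $w\in G_B$; put $\pi_B(w):=\pi_A(w)|_{\mathcal H_B}$. Let $D=G_A\times_{G_B}\mathcal H_B$ be the quotient of $G_A\times\mathcal H_B$ by the relation $(u,f)\sim(uw,\pi_B(w^{-1})f)$, $w\in G_B$, let $\Pi\colon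 D\to G_A/G_B$, $[(u,f)]\mapsto uG_B$, with fibers $D_s=\Pi^{-1}(s)$, and let $\Theta\colon D\to\mathcal H_A$, $\Theta([(u,f)])=\pi_A(u)f$. Each $D_s$ is a complex normed space through the bijection $\Theta|_{D_s}$ onto $\pi_A(u)\mathcal H_B$ ($s=uG_B$). For $\xi\in D_s$, $\eta\in D_t$ put $(\xi\mid\eta)_{s,t}=(\Theta\xi\mid\Theta\eta)_{\mathcal H_A}$, and on $G_A/G_B$ use the involution $(uG_B)^{-*}=u^{-*}G_B$. The spaces $G_A/G_B$ and $D$ carry the Banach manifold structures over $\mathbb K$ for which the quotient maps $G_A\to G_A/G_B$ and $G_A\times\mathcal H_B\to D$ are submersions. "Smooth" means $C^\infty$ over $\mathbb K$ (so holomorphic if $\mathbb K=\mathbb C$). Define $K(s,t)\colon D_t\to D_s$ by $K(uG_B,vG_B)[(v,f)]=[(u,P(\pi_A(u^{-1})\pi_A(v)f))]$, and for $\eta\in D_t$ let $K_\eta:=K(\cdot,t)\eta$. **Theorem.** The quotient manifold structures on $G_A/G_B$ and $D$ exist. The family $K$ consists of bounded operators and is a reproducing $(-*)$-kernel: for all $n$,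 $t_1,\dots,t_n\in G_A/G_B$ and $\eta_j\in D_{t_j^{-*}}$, $$\sum_{j,l}\bigl(\eta_j\mid K(t_j,t_l^{-*})\eta_l\bigr)_{t_j^{-*},t_j}=\sum_{j,l}\bigl(K(t_l,t_j^{-*})\eta_j\mid\eta_l\bigr)_{t_l,t_l^{-*}}\ge0 .$$ Let $\mathcal H^K$ be the associated Hilbert space, i.e. the completion of $\mathcal H^K_0=\operatorname{span}_{\mathbb C}\{K_\xi\mid\xi\in D\}$ for the scalar product with $(K_\eta\mid K_\xi)=(K(s^{-*},t)\eta\mid\xi)_{s^{-*},s}$ for $\xi\in D_s$, $\eta\in D_t$, and let $\widehat K(\xi)=K_\xi\in\mathcal H^K$. (a) The formula $(\gamma(h))(uG_B)=[(u,P(\pi_A(u^{-1})h))]$ defines a linear operator $\gamma$ from $\mathcal H_A$ to the space of smooth sections of $\Pi$, with $\operatorname{Ker}\gamma=(\operatorname{span}_{\mathbb C}\pi_A(G_A)\mathcal H_B)^\perp$. There is a linear isometry $W\colon\mathcal H^K\to\mathcal H_A$ with $W(K_\eta)=\Theta(\eta)$ for $\eta\in D$ and with range $\overline{\operatorname{span}}_{\mathbb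 C}\,\pi_A(G_A)\mathcal H_B$. The operator $\iota:=\gamma\circ W$ is the canonical inclusion of $\mathcal H^K$ into the space of sections (injective, the identity on $\mathcal H^K_0$, with continuous evaluations), $\gamma(\mathcal H_A)=\iota(\mathcal H^K)$, and $\gamma\circ\Theta=\widehat K$ under this inclusion. (b) For every $t\in G_A/G_B$ the evaluation $\mathrm{ev}^\iota_t=\iota(\cdot)(t)\colon\mathcal H^K\to D_t$ is a bounded linear operator, there is a bounded linear operator $(\mathrm{ev}^\iota_t)^{-*}\colon D_{t^{-*}}\to\mathcal H^K$ with $(\mathrm{ev}^\iota_tF\mid y)_{t,t^{-*}}=(F\mid(\mathrm{ev}^\iota_t)^{-*}y)_{\mathcal H^K}$ for all $F\in\mathcal H^K$, $y\in D_{t^{-*}}$, and $K(s,t^{-*})=\mathrm{ev}^\iota_s\circ(\mathrm{ev}^\iota_t)^{-*}$ for all $s,t\in G_A/G_B$. (c) The representation $(v\cdot\sigma)(t)=v\cdot\sigma(v^{-1}t)$ of $G_A$ on the sections of $\Pi$, where $v\cdot[(u,f)]=[(vu,f)]$, preserves the smooth sections, and $\gamma(\pi_A(v)h)=v\cdot\gamma(h)$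 for all $v\in G_A$, $h\in\mathcal H_A$. -/

import Mathlib

open scoped Manifold ContDiff ComplexConjugate

/-! ### Banach manifolds: Banach-Lie subgroups and quotient manifolds -/

section Manifolds

/-- A subgroup `B` of a Banach-Lie group `G` over `𝕜` is a Banach-Lie subgroup if it is a (split)
submanifold of `G`: around each of its points there is a chart of `G` in which `B` is given by a
complemented closed linear subspace of the model space. -/
def IsBanachLieSubgroup (𝕜 : Type*) [NontriviallyNormedField 𝕜] (E : Type*) [NormedAddCommGroup E]
    [NormedSpace 𝕜 E] {G : Type*} [TopologicalSpace G] [ChartedSpace E G] [Group G]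
    (B : Subgroup G) : Prop :=
  ∀ b ∈ B, ∃ φ ∈ IsManifold.maximalAtlas 𝓘(𝕜, E) ∞ G, ∃ F : Submodule 𝕜 E,
    F.ClosedComplemented ∧ b ∈ φ.source ∧ ∀ g ∈ φ.source, g ∈ B ↔ φ g ∈ F

universe w

/-- A quotient manifold structure for a map `p : M → X` from a manifold `M` onto a topological
space `X`: a Banach manifold structure on `X` for which `p` is a submersion. If `p` is surjective,
there is at most one such structure (up to equivalence of atlases). -/
structure QuotientManifold {𝕜 : Type*} [NontriviallyNormedField 𝕜] {E' : Type*}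
    [NormedAddCommGroup E'] [NormedSpace 𝕜 E'] {H' : Type*} [TopologicalSpace H']
    (I : ModelWithCorners 𝕜 E' H') {M : Type*} [TopologicalSpace M] [ChartedSpace H' M]
    {X : Type*} [TopologicalSpace X] (p : M → X) where
  /-- the model Banach space -/
  Model : Type w
  [normedAddCommGroup : NormedAddCommGroup Model]
  [normedSpace : NormedSpace 𝕜 Model]
  [completeSpace : CompleteSpace Model]
  [chartedSpace : ChartedSpace Model X]
  [isManifold : IsManifold 𝓘(𝕜, Model) ∞ X]
  submersion : ∀ m : M, Manifold.IsSubmersionAt I 𝓘(𝕜, Model) ∞ p m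

attribute [instance] QuotientManifold.normedAddCommGroup QuotientManifold.normedSpace
  QuotientManifold.completeSpace

end Manifolds

/-! ### The data `(π_A, π_B, P)` and the bundle `D = G_A ×_{G_B} H_B` -/

noncomputable section

/-- The algebraic part of the data `(π_A, π_B, P)`. Here `G = G_A` is a group with an involution
`u ↦ star u`, `H = H_A` is a complex Hilbert space, `B = G_B`, `HB = H_B`, `π = π_A`; the
representation `π_B` is the restriction of `π_A`, and `P` is the orthogonal projection onto
`H_B`. -/
structure RepresentationPair (G H : Type*) [Group G] [StarMul G] [NormedAddCommGroup H]
    [InnerProductSpace ℂ H] [CompleteSpace H] where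
  /-- the subgroup `G_B` -/
  B : Subgroup G
  star_mem : ∀ w ∈ B, star w ∈ B
  /-- the `*`-representation `π_A` -/
  π : G →* (H →L[ℂ] H)
  map_star : ∀ u, π (star u) = ContinuousLinearMap.adjoint (π u)
  /-- the closed subspace `H_B` -/
  HB : Submodule ℂ H
  isClosed_HB : IsClosed (HB : Set H)
  map_mem : ∀ w ∈ B, ∀ f ∈ HB, π w f ∈ HB

namespace RepresentationPair

variable {G H : Type*} [Group G] [StarMul G] [NormedAddCommGroup H]
  [InnerProductSpace ℂ H] [CompleteSpace H] (d : RepresentationPair G H)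

instance : CompleteSpace d.HB := d.isClosed_HB.completeSpace_coe

/-- The orthogonal projection `P : H_A → H_B`. -/
def P : H →L[ℂ] d.HB := d.HB.orthogonalProjectionOnto

/-- The base space `G_A / G_B`. -/
abbrev Base : Type _ := G ⧸ d.B

/-- The quotient map `G_A → G_A / G_B`. -/
def toBase (u : G) : d.Base := QuotientGroup.mk u

theorem π_mul_apply (u v : G) (h : H) : d.π (u * v) h = d.π u (d.π v h) := by
  rw [map_mul]; rfl

@[simp] theorem π_inv_self (u : G) (h : H) : d.π u⁻¹ (d.π u h) = h := by
  rw [← π_mul_apply]; simp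

@[simp] theorem π_self_inv (u : G) (h : H) : d.π u (d.π u⁻¹ h) = h := by
  rw [← π_mul_apply]; simp

/-- The equivalence relation on `G_A × H_B`: `(u, f) ∼ (u', f')` iff there is `w ∈ G_B` with
`u' = u w` and `f' = π_B(w⁻¹) f`. -/
def setoid : Setoid (G × d.HB) where
  r x y := ∃ w ∈ d.B, y.1 = x.1 * w ∧ (y.2 : H) = d.π w⁻¹ x.2
  iseqv :=
    { refl := fun x => ⟨1, d.B.one_mem, by simp⟩
      symm := by
        rintro x y ⟨w, hw, h1, h2⟩
        exact ⟨w⁻¹, d.B.inv_mem hw, by simp [h1], by simp [h2]⟩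
      trans := by
        rintro x y z ⟨w, hw, h1, h2⟩ ⟨w', hw', h1', h2'⟩
        exact ⟨w * w', d.B.mul_mem hw hw', by rw [h1', h1, mul_assoc],
          by rw [h2', h2, mul_inv_rev, π_mul_apply]⟩ }

/-- The total space `D = G_A ×_{G_B} H_B`. -/
def Total : Type _ := Quotient d.setoid

/-- The quotient map `(u, f) ↦ [(u, f)]`, `G_A × H_B → D`. -/
def toTotal (x : G × d.HB) : d.Total := Quotient.mk d.setoid x

/-- The quotient topology on `D`. -/
instance [TopologicalSpace G] : TopologicalSpace d.Total :=
  inferInstanceAs (TopologicalSpace (Quotient d.setoid))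

/-- The bundle projection `Π : [(u, f)] ↦ u G_B`. -/
def proj : d.Total → d.Base :=
  Quotient.lift (fun x => d.toBase x.1) (by
    rintro x y ⟨w, hw, h1, -⟩
    refine QuotientGroup.eq.2 ?_
    rw [h1, ← mul_assoc, inv_mul_cancel, one_mul]
    exact hw)

/-- The basic mapping `Θ : [(u, f)] ↦ π_A(u) f`. -/
def Θ : d.Total → H :=
  Quotient.lift (fun x => d.π x.1 x.2) (by
    rintro x y ⟨w, hw, h1, h2⟩
    rw [h1, h2, π_mul_apply, π_self_inv])

@[simp] theorem proj_toTotal (x : G × d.HB) : d.proj (d.toTotal x) = d.toBase x.1 := rfl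

@[simp] theorem Θ_toTotal (x : G × d.HB) : d.Θ (d.toTotal x) = d.π x.1 x.2 := rfl

theorem toBase_surjective (s : d.Base) : ∃ u, d.toBase u = s :=
  QuotientGroup.mk_surjective s

/-- The fiber `D_s = Π⁻¹(s)`. -/
@[ext] structure Fiber (s : d.Base) where
  /-- an element of the fiber, as an element of `D` -/
  val : d.Total
  proj_val : d.proj val = s

variable {d}

/-- The vector `Θ(ξ)` for an element `ξ` of a fiber. -/
def Fiber.vec {s : d.Base} (ξ : d.Fiber s) : H := d.Θ ξ.val

variable (d)

/-- The element `[(u, f)]` of the fiber over `u G_B`. -/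
def fiberMk (u : G) (f : d.HB) : d.Fiber (d.toBase u) := ⟨d.toTotal (u, f), rfl⟩

@[simp] theorem vec_fiberMk (u : G) (f : d.HB) : (d.fiberMk u f).vec = d.π u f := rfl

variable {d}

theorem exists_fiberMk {u : G} (ξ : d.Fiber (d.toBase u)) : ∃ f, ξ = d.fiberMk u f := by
  obtain ⟨ξ, hξ⟩ := ξ
  induction ξ using Quotient.inductionOn with
  | h x =>
    have hw : u⁻¹ * x.1 ∈ d.B := QuotientGroup.eq.1 (Eq.symm hξ)
    refine ⟨⟨d.π (u⁻¹ * x.1) x.2, d.map_mem _ hw _ x.2.2⟩, Fiber.ext ?_⟩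
    refine Quotient.sound (s := d.setoid) ⟨(u⁻¹ * x.1)⁻¹, d.B.inv_mem hw, ?_, ?_⟩
    · simp
    · simp

theorem Fiber.vec_injective {s : d.Base} :
    Function.Injective (Fiber.vec : d.Fiber s → H) := by
  obtain ⟨u, rfl⟩ := d.toBase_surjective s
  intro ξ η h
  obtain ⟨f, rfl⟩ := exists_fiberMk ξ
  obtain ⟨g, rfl⟩ := exists_fiberMk η
  have h' : d.π u⁻¹ (d.π u f) = d.π u⁻¹ (d.π u g) := by
    simpa using congrArg (d.π u⁻¹) h
  rw [π_inv_self, π_inv_self] at h'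
  rw [Subtype.ext h']

variable (d)

/-- The subspace `Θ(D_s)` of `H_A`, that is, `π_A(u) H_B` for `s = u G_B`. -/
def fiberSpace (s : d.Base) : Submodule ℂ H where
  carrier := Set.range (Fiber.vec : d.Fiber s → H)
  zero_mem' := by
    obtain ⟨u, rfl⟩ := d.toBase_surjective s
    exact ⟨d.fiberMk u 0, by simp⟩
  add_mem' := by
    obtain ⟨u, rfl⟩ := d.toBase_surjective s
    rintro _ _ ⟨ξ, rfl⟩ ⟨η, rfl⟩
    obtain ⟨f, rfl⟩ := exists_fiberMk ξ
    obtain ⟨g, rfl⟩ := exists_fiberMk η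
    exact ⟨d.fiberMk u (f + g), by simp⟩
  smul_mem' := by
    obtain ⟨u, rfl⟩ := d.toBase_surjective s
    rintro c _ ⟨ξ, rfl⟩
    obtain ⟨f, rfl⟩ := exists_fiberMk ξ
    exact ⟨d.fiberMk u (c • f), by simp⟩

/-- The bijection `[(u, f)] ↦ π_A(u) f` of `D_s` onto `π_A(u) H_B`. -/
def fiberEquiv (s : d.Base) : d.Fiber s ≃ d.fiberSpace s :=
  Equiv.ofInjective Fiber.vec Fiber.vec_injective

/-- The complex linear structure and the norm `‖[(u, f)]‖ = ‖π_A(u) f‖` of the fiber `D_s`, carried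
over from `π_A(u) H_B`. -/
instance (s : d.Base) : NormedAddCommGroup (d.Fiber s) := (d.fiberEquiv s).normedAddCommGroup

instance (s : d.Base) : NormedSpace ℂ (d.Fiber s) := (d.fiberEquiv s).normedSpace ℂ

/-- `Θ` on the fiber `D_s`, as a linear isometry into `H_A`. -/
def vecL (s : d.Base) : d.Fiber s →ₗᵢ[ℂ] H where
  toFun := Fiber.vec
  map_add' ξ η := congrArg Subtype.val
    ((d.fiberEquiv s).apply_symm_apply (d.fiberEquiv s ξ + d.fiberEquiv s η))
  map_smul' c ξ := congrArg Subtype.val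
    ((d.fiberEquiv s).apply_symm_apply (c • d.fiberEquiv s ξ))
  norm_map' _ := rfl

variable {d}

@[simp] theorem Fiber.vec_add {s : d.Base} (ξ η : d.Fiber s) : (ξ + η).vec = ξ.vec + η.vec :=
  (d.vecL s).map_add ξ η

@[simp] theorem Fiber.vec_smul {s : d.Base} (c : ℂ) (ξ : d.Fiber s) :
    (c • ξ).vec = c • ξ.vec :=
  (d.vecL s).map_smul c ξ

@[simp] theorem Fiber.vec_zero {s : d.Base} : (0 : d.Fiber s).vec = 0 :=
  (d.vecL s).map_zero

theorem Fiber.norm_def {s : d.Base} (ξ : d.Fiber s) : ‖ξ‖ = ‖ξ.vec‖ := rfl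

/-- The like-Hermitian structure `([(u, f)] | [(v, g)])_{s,t} = (π_A(u) f | π_A(v) g)`, linear in
the first variable and antilinear in the second one (the inner product of Mathlib is linear in the
second variable). -/
def pairing {s t : d.Base} (ξ : d.Fiber s) (η : d.Fiber t) : ℂ := inner ℂ η.vec ξ.vec

theorem star_inv_mem {w : G} (hw : w ∈ d.B) : star w⁻¹ ∈ d.B :=
  d.star_mem _ (d.B.inv_mem hw)

variable (d)

/-- The involution `u G_B ↦ u^{-*} G_B` of the base, where `u^{-*} = (u⁻¹)^*`. -/
def inv : d.Base → d.Base :=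
  Quotient.map' (fun u => star u⁻¹) (by
    intro u v h
    rw [QuotientGroup.leftRel_apply] at h ⊢
    have h1 := star_inv_mem h
    have h2 : (star u⁻¹)⁻¹ * star v⁻¹ = star (u⁻¹ * v)⁻¹ := by
      rw [mul_inv_rev, inv_inv, star_mul, star_inv, inv_inv]
    rw [h2]
    exact h1)

@[simp] theorem inv_toBase (u : G) : d.inv (d.toBase u) = d.toBase (star u⁻¹) := rfl

variable {d}

theorem P_π {w : G} (hw : w ∈ d.B) (h : H) : ((d.P (d.π w h) : d.HB) : H) = d.π w (d.P h) := by
  refine (Submodule.eq_starProjection_of_mem_of_inner_eq_zero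
    (d.map_mem w hw _ (d.P h).2) ?_).symm ▸ rfl
  intro f hf
  rw [← map_sub, ← ContinuousLinearMap.adjoint_inner_right, ← d.map_star]
  exact Submodule.starProjection_inner_eq_zero h _ (d.map_mem _ (d.star_mem w hw) f hf)

/-! ### The operator `γ`, the kernel `K`, and the natural representation on sections -/

variable (d)

/-- The map `u G_B ↦ [(u, P(π_A(u⁻¹) h))]`. -/
def γRaw (h : H) : d.Base → d.Total :=
  Quotient.lift (fun u => d.toTotal (u, d.P (d.π u⁻¹ h))) (by
    intro u v huv
    have hw : u⁻¹ * v ∈ d.B := QuotientGroup.leftRel_apply.1 huv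
    refine Quotient.sound (s := d.setoid) ⟨u⁻¹ * v, hw, by simp, ?_⟩
    dsimp only
    rw [← P_π (d.B.inv_mem hw), ← π_mul_apply]
    simp)

/-- The operation `(u G_B, [(v, f)]) ↦ [(u, P(π_A(u⁻¹) π_A(v) f))]`. -/
def kernelRaw : d.Base → d.Total → d.Total :=
  Quotient.lift₂ (s₁ := QuotientGroup.leftRel d.B) (s₂ := d.setoid)
    (fun u x => d.toTotal (u, d.P (d.π u⁻¹ (d.π x.1 x.2)))) (by
    rintro u x v y huv ⟨w', hw', h1, h2⟩
    have hw : u⁻¹ * v ∈ d.B := QuotientGroup.leftRel_apply.1 huv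
    refine Quotient.sound (s := d.setoid) ⟨u⁻¹ * v, hw, by simp, ?_⟩
    dsimp only
    rw [h1, h2, ← P_π (d.B.inv_mem hw), ← π_mul_apply, ← π_mul_apply, ← π_mul_apply,
      ← π_mul_apply]
    congr 4
    group)

/-- The space of all cross sections of `Π : D → G_A / G_B`. -/
abbrev Sections : Type _ := ∀ s : d.Base, d.Fiber s

/-- The section `u G_B ↦ [(u, P(π_A(u⁻¹) h))]`. -/
def γFun (h : H) : d.Sections := fun s =>
  ⟨d.γRaw h s, by obtain ⟨u, rfl⟩ := d.toBase_surjective s; rfl⟩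

theorem γFun_toBase (h : H) (u : G) :
    d.γFun h (d.toBase u) = d.fiberMk u (d.P (d.π u⁻¹ h)) := rfl

/-- The linear operator `γ`, with `(γ(h))(u G_B) = [(u, P(π_A(u⁻¹) h))]`. -/
def γ : H →ₗ[ℂ] d.Sections where
  toFun := d.γFun
  map_add' h k := by
    funext s
    obtain ⟨u, rfl⟩ := d.toBase_surjective s
    refine Fiber.vec_injective ?_
    simp [γFun_toBase]
  map_smul' c h := by
    funext s
    obtain ⟨u, rfl⟩ := d.toBase_surjective s
    refine Fiber.vec_injective ?_
    simp [γFun_toBase]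

theorem γ_apply (h : H) (u : G) : d.γ h (d.toBase u) = d.fiberMk u (d.P (d.π u⁻¹ h)) := rfl

/-- A (not necessarily smooth) section of the bundle `Hom(p₂^* Π, p₁^* Π)`: a family of bounded
linear operators `K(s, t) : D_t → D_s`. -/
abbrev KernelFamily : Type _ := ∀ s t : d.Base, d.Fiber t →L[ℂ] d.Fiber s

/-- The map `K(s, t) : D_t → D_s`, `[(v, f)] ↦ [(u, P(π_A(u⁻¹) π_A(v) f))]` for `s = u G_B`. -/
def kernelFun (s t : d.Base) (η : d.Fiber t) : d.Fiber s :=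
  ⟨d.kernelRaw s η.val, by
    obtain ⟨u, rfl⟩ := d.toBase_surjective s
    obtain ⟨v, rfl⟩ := d.toBase_surjective t
    obtain ⟨f, rfl⟩ := exists_fiberMk η
    rfl⟩

theorem vec_kernelFun (u : G) {t : d.Base} (η : d.Fiber t) :
    (d.kernelFun (d.toBase u) t η).vec = d.π u (d.P (d.π u⁻¹ η.vec)) := by
  obtain ⟨v, rfl⟩ := d.toBase_surjective t
  obtain ⟨f, rfl⟩ := exists_fiberMk η
  rfl

/-- The kernel `K(s, t)[(v, f)] = [(u, P(π_A(u⁻¹) π_A(v) f))]` for `s = u G_B`, `t = v G_B`. -/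
def kernel : d.KernelFamily := fun s t =>
  { toFun := d.kernelFun s t
    map_add' := by
      intro η η'
      obtain ⟨u, rfl⟩ := d.toBase_surjective s
      refine Fiber.vec_injective ?_
      simp [vec_kernelFun]
    map_smul' := by
      intro c η
      obtain ⟨u, rfl⟩ := d.toBase_surjective s
      refine Fiber.vec_injective ?_
      simp [vec_kernelFun]
    cont := by
      obtain ⟨u, rfl⟩ := d.toBase_surjective s
      refine (d.vecL (d.toBase u)).isometry.isEmbedding.continuous_iff.2 ?_
      have hc : Continuous fun η : d.Fiber t => d.π u (d.P (d.π u⁻¹ (d.vecL t η)) : d.HB) := by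
        fun_prop
      exact hc.congr fun η => (d.vec_kernelFun u η).symm }

theorem kernel_apply (u v : G) (f : d.HB) :
    d.kernel (d.toBase u) (d.toBase v) (d.fiberMk v f) =
      d.fiberMk u (d.P (d.π u⁻¹ (d.π v f))) := rfl

/-- The action `v · [(u, f)] = [(v u, f)]` of `G_A` on `D`. -/
def act (v : G) : d.Total → d.Total :=
  Quotient.map (sa := d.setoid) (sb := d.setoid) (fun x => (v * x.1, x.2)) (by
    rintro x y ⟨w, hw, h1, h2⟩
    exact ⟨w, hw, by simp [h1, mul_assoc], h2⟩)

theorem proj_act (v : G) (ξ : d.Total) : d.proj (d.act v ξ) = v • d.proj ξ := by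
  induction ξ using Quotient.inductionOn with
  | h x => rfl

theorem Θ_act (v : G) (ξ : d.Total) : d.Θ (d.act v ξ) = d.π v (d.Θ ξ) := by
  induction ξ using Quotient.inductionOn with
  | h x => exact d.π_mul_apply v x.1 x.2

/-- The section `v · σ`, with `(v · σ)(t) = v · σ(v⁻¹ t)`. -/
def translate (v : G) (σ : d.Sections) : d.Sections := fun t =>
  ⟨d.act v (σ (v⁻¹ • t)).val, by rw [proj_act, Fiber.proj_val, smul_inv_smul]⟩

theorem vec_translate (v : G) (σ : d.Sections) (t : d.Base) :
    (d.translate v σ t).vec = d.π v (σ (v⁻¹ • t)).vec :=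
  d.Θ_act v _

/-- The natural representation of `G_A` on the space of cross sections of `Π`. -/
def sectionRep : Representation ℂ G d.Sections where
  toFun v :=
    { toFun := d.translate v
      map_add' := fun σ τ => by
        funext t
        refine Fiber.vec_injective ?_
        rw [Pi.add_apply, Fiber.vec_add]
        simp only [vec_translate, Pi.add_apply, Fiber.vec_add, map_add]
      map_smul' := fun c σ => by
        funext t
        refine Fiber.vec_injective ?_
        rw [RingHom.id_apply, Pi.smul_apply, Fiber.vec_smul]
        simp only [vec_translate, Pi.smul_apply, Fiber.vec_smul, map_smul] }
  map_one' := by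
    refine LinearMap.ext fun σ => funext fun t => Fiber.vec_injective ?_
    change (d.translate 1 σ t).vec = (σ t).vec
    rw [vec_translate, map_one, inv_one, one_smul]
    rfl
  map_mul' v v' := by
    refine LinearMap.ext fun σ => funext fun t => Fiber.vec_injective ?_
    change (d.translate (v * v') σ t).vec = (d.translate v (d.translate v' σ) t).vec
    rw [vec_translate, vec_translate, vec_translate, π_mul_apply, mul_inv_rev, mul_smul]

/-! ### Smooth sections -/

section Smooth

universe uE uH uk uG

variable {H : Type uH} [NormedAddCommGroup H] [InnerProductSpace ℂ H] [CompleteSpace H]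
  {G : Type uG} [Group G] [StarMul G] (d : RepresentationPair G H)

/-- The structures of quotient manifold on `G_A / G_B`, for the map `u ↦ u G_B`. -/
abbrev BaseManifold (𝕜 : Type uk) [NontriviallyNormedField 𝕜] (E : Type uE)
    [NormedAddCommGroup E] [NormedSpace 𝕜 E] [TopologicalSpace G] [ChartedSpace E G] :
    Type (max (max uE uG uk) (uE + 1)) :=
  QuotientManifold.{uE, uk, uE, uE, uG, uG} 𝓘(𝕜, E) d.toBase

/-- The structures of quotient manifold on `D`, for the map `(u, f) ↦ [(u, f)]`,
`G_A × H_B → D`. -/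
abbrev BundleManifold (𝕜 : Type uk) [NontriviallyNormedField 𝕜] (E : Type uE)
    [NormedAddCommGroup E] [NormedSpace 𝕜 E] [TopologicalSpace G] [ChartedSpace E G]
    [NormedSpace 𝕜 d.HB] : Type (max (max (max uE uH) (max uG uH) uk) (max uE uH + 1)) :=
  QuotientManifold.{max uE uH, uk, max uE uH, max uE uH, max uG uH, max uG uH}
    (𝓘(𝕜, E).prod 𝓘(𝕜, d.HB)) d.toTotal

variable {d} {𝕜 : Type uk} [NontriviallyNormedField 𝕜] {E : Type uE} [NormedAddCommGroup E]
  [NormedSpace 𝕜 E] [TopologicalSpace G] [ChartedSpace E G] [NormedSpace 𝕜 d.HB]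

/-- The section `σ` of `Π : D → G_A / G_B` is of class `C^∞` over `𝕜` (smooth for `𝕜 = ℝ`,
holomorphic for `𝕜 = ℂ`) with respect to the quotient manifold structures of `G_A / G_B` and
`D`. -/
def IsSmoothSection (Z : d.BaseManifold 𝕜 E) (D : d.BundleManifold 𝕜 E) (σ : d.Sections) : Prop :=
  letI := Z.chartedSpace
  letI := D.chartedSpace
  ContMDiff 𝓘(𝕜, Z.Model) 𝓘(𝕜, D.Model) ∞ fun s : d.Base => (σ s).val

end Smooth

/-! ### Reproducing `(-*)`-kernels and their Hilbert spaces -/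

variable {d}

open scoped ComplexOrder in
/-- `K` is a reproducing `(-*)`-kernel: it is `(-*)`-positive definite. (The inequality in `ℂ`
means that the right-hand side is real and nonnegative.) -/
def IsReproducingKernel (K : d.KernelFamily) : Prop :=
  ∀ (n : ℕ) (t : Fin n → d.Base) (η : ∀ j, d.Fiber (d.inv (t j))),
    (∑ j, ∑ l, pairing (η j) (K (t j) (d.inv (t l)) (η l)) =
      ∑ j, ∑ l, pairing (K (t l) (d.inv (t j)) (η j)) (η l)) ∧
    0 ≤ ∑ j, ∑ l, pairing (K (t l) (d.inv (t j)) (η j)) (η l)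

/-- The section `K_ξ = K(·, s) ξ` for `ξ ∈ D_s`. -/
def KernelFamily.sec (K : d.KernelFamily) {s : d.Base} (ξ : d.Fiber s) : d.Sections :=
  fun z => K z s ξ

/-- The space `H^K_0`, the linear span of the sections `K_ξ` with `ξ ∈ D`. -/
def KernelFamily.span₀ (K : d.KernelFamily) : Submodule ℂ d.Sections :=
  Submodule.span ℂ (Set.range fun ξ : (s : d.Base) × d.Fiber s => K.sec ξ.2)

/-- The element `K_ξ` of `H^K_0`. -/
def KernelFamily.sec₀ (K : d.KernelFamily) {s : d.Base} (ξ : d.Fiber s) : K.span₀ :=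
  ⟨K.sec ξ, Submodule.subset_span ⟨⟨s, ξ⟩, rfl⟩⟩

theorem inv_inv (s : d.Base) : d.inv (d.inv s) = s := by
  obtain ⟨u, rfl⟩ := d.toBase_surjective s
  rw [inv_toBase, inv_toBase, star_inv, star_star, _root_.inv_inv]

theorem exists_inv_eq (s : d.Base) : ∃ t, d.inv t = s := ⟨d.inv s, inv_inv s⟩

theorem pairing_smul_left {s t : d.Base} (c : ℂ) (ξ : d.Fiber s) (η : d.Fiber t) :
    pairing (c • ξ) η = c * pairing ξ η := by
  rw [pairing, Fiber.vec_smul, inner_smul_right, pairing]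

theorem pairing_smul_right {s t : d.Base} (c : ℂ) (ξ : d.Fiber s) (η : d.Fiber t) :
    pairing ξ (c • η) = conj c * pairing ξ η := by
  rw [pairing, Fiber.vec_smul, inner_smul_left, pairing]

theorem pairing_add_left {s t : d.Base} (ξ ξ' : d.Fiber s) (η : d.Fiber t) :
    pairing (ξ + ξ') η = pairing ξ η + pairing ξ' η := by
  rw [pairing, Fiber.vec_add, inner_add_right, pairing, pairing]

theorem pairing_nondegenerate {s : d.Base} (η : d.Fiber (d.inv s))
    (h : ∀ ξ : d.Fiber s, pairing η ξ = 0) : η = 0 := by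
  obtain ⟨u, rfl⟩ := d.toBase_surjective s
  obtain ⟨g, rfl⟩ := exists_fiberMk (u := star u⁻¹) η
  have h1 : pairing (d.fiberMk (star u⁻¹) g) (d.fiberMk u g) = 0 := h (d.fiberMk u g)
  rw [pairing, vec_fiberMk, vec_fiberMk, d.map_star,
    ContinuousLinearMap.adjoint_inner_right, π_inv_self, inner_self_eq_zero] at h1
  refine Fiber.vec_injective (Eq.trans ?_ Fiber.vec_zero.symm)
  exact (vec_fiberMk d _ g).trans (by rw [h1, map_zero])

namespace KernelFamily

/-- The number `(K(s^{-*}, t) η | ξ)_{s^{-*}, s}` for `η ∈ D_t` and `ξ ∈ D_s`. -/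
def form (K : d.KernelFamily) {s t : d.Base} (η : d.Fiber t) (ξ : d.Fiber s) : ℂ :=
  pairing (K (d.inv s) t η) ξ

/-- The number `∑ (F(s_l^{-*}) | ξ_l)_{s_l^{-*}, s_l}`, for a section `F` and a finite formal
linear combination of elements `ξ_l ∈ D_{s_l}`. -/
def formAux (F : d.Sections) (a : ((s : d.Base) × d.Fiber s) →₀ ℂ) : ℂ :=
  a.sum fun y c => conj c * pairing (F (d.inv y.1)) y.2

/-- The section `∑ c_j K_{ξ_j}` associated with a formal linear combination. -/
def comb (K : d.KernelFamily) : (((s : d.Base) × d.Fiber s) →₀ ℂ) →ₗ[ℂ] d.Sections :=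
  Finsupp.linearCombination ℂ fun ξ => K.sec ξ.2

theorem exists_comb {K : d.KernelFamily} (F : K.span₀) : ∃ a, K.comb a = F :=
  (Finsupp.mem_span_range_iff_exists_finsupp.1 F.2)

theorem formAux_comb (K : d.KernelFamily) (a b : ((s : d.Base) × d.Fiber s) →₀ ℂ) :
    formAux (K.comb b) a =
      a.sum fun y c' => b.sum fun x c => conj c' * c * K.form x.2 y.2 := by
  refine Finsupp.sum_congr fun y _ => ?_
  have h : K.comb b (d.inv y.1) = b.sum fun x c => c • K (d.inv y.1) x.1 x.2 := by
    rw [comb, Finsupp.linearCombination_apply, Finsupp.sum, Finset.sum_apply]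
    rfl
  have h' : pairing (K.comb b (d.inv y.1)) y.2 = b.sum fun x c => c * K.form x.2 y.2 := by
    change inner ℂ y.2.vec (d.vecL _ (K.comb b (d.inv y.1))) = _
    rw [h, Finsupp.sum, map_sum, inner_sum]
    refine Finset.sum_congr rfl fun x _ => ?_
    rw [map_smul, inner_smul_right]
    rfl
  rw [h', Finsupp.mul_sum]
  exact Finsupp.sum_congr fun x _ => (mul_assoc _ _ _).symm

end KernelFamily

open scoped ComplexOrder in
theorem IsReproducingKernel.sum_nonneg {K : d.KernelFamily} (hK : IsReproducingKernel K)
    {n : ℕ} (s : Fin n → d.Base) (ξ : ∀ j, d.Fiber (s j)) :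
    0 ≤ ∑ j, ∑ l, K.form (ξ j) (ξ l) := by
  choose t ht using fun j => exists_inv_eq (s j)
  obtain rfl : (fun j => d.inv (t j)) = s := funext ht
  have h : ∀ j l, K.form (ξ j) (ξ l) = pairing (K (t l) (d.inv (t j)) (ξ j)) (ξ l) := by
    intro j l
    rw [KernelFamily.form, inv_inv]
  simp only [h]
  exact (hK n t ξ).2

open scoped ComplexOrder in
theorem IsReproducingKernel.formAux_nonneg {K : d.KernelFamily} (hK : IsReproducingKernel K)
    (a : ((s : d.Base) × d.Fiber s) →₀ ℂ) : 0 ≤ KernelFamily.formAux (K.comb a) a := by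
  let e := a.support.equivFin
  have h := hK.sum_nonneg (fun j => (e.symm j).1.1)
    (fun j => a (e.symm j).1 • (e.symm j).1.2)
  rw [KernelFamily.formAux_comb, Finsupp.sum_comm]
  refine h.trans_eq ?_
  simp only [Finsupp.sum]
  rw [← Finset.sum_coe_sort a.support, ← e.symm.sum_comp]
  refine Finset.sum_congr rfl fun j _ => ?_
  rw [← Finset.sum_coe_sort a.support, ← e.symm.sum_comp]
  refine Finset.sum_congr rfl fun l _ => ?_
  rw [KernelFamily.form, map_smul, pairing_smul_left, pairing_smul_right, KernelFamily.form]
  ring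

theorem IsReproducingKernel.form_conj {K : d.KernelFamily} (hK : IsReproducingKernel K)
    {s t : d.Base} (η : d.Fiber t) (ξ : d.Fiber s) :
    conj (K.form ξ η) = K.form η ξ := by
  classical
  have him : ∀ a, (KernelFamily.formAux (K.comb a) a).im = 0 := fun a =>
    (Complex.nonneg_iff.1 (hK.formAux_nonneg a)).2.symm
  have hs : ∀ x : (s : d.Base) × d.Fiber s, (K.form x.2 x.2).im = 0 := by
    intro x
    have := him (Finsupp.single x 1)
    simpa [KernelFamily.formAux_comb] using this
  have key : ∀ c : ℂ, (conj c * K.form ξ η + c * K.form η ξ).im = 0 := by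
    intro c
    have h := him (Finsupp.single ⟨s, ξ⟩ 1 + Finsupp.single ⟨t, η⟩ c)
    rw [KernelFamily.formAux_comb, Finsupp.sum_add_index' (by simp) (by
        intros; rw [← Finsupp.sum_add]; congr 1; funext x z; simp; ring)] at h
    rw [Finsupp.sum_single_index (by simp), Finsupp.sum_single_index (by simp),
      Finsupp.sum_add_index' (by simp) (by intros; ring),
      Finsupp.sum_add_index' (by simp) (by intros; ring)] at h
    simp only [mul_zero, zero_mul, Finsupp.sum_single_index, map_one, one_mul, mul_one] at h
    have h1 := hs ⟨s, ξ⟩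
    have h2 := hs ⟨t, η⟩
    simp only [Complex.add_im, Complex.mul_im, Complex.mul_re, Complex.conj_re,
      Complex.conj_im] at h h1 h2 ⊢
    rw [h1, h2] at h
    linarith
  have h1 := key 1
  have h2 := key Complex.I
  simp at h1 h2
  apply Complex.ext <;> simp <;> linarith

theorem IsReproducingKernel.formAux_conj {K : d.KernelFamily} (hK : IsReproducingKernel K)
    (a b : ((s : d.Base) × d.Fiber s) →₀ ℂ) :
    conj (KernelFamily.formAux (K.comb a) b) = KernelFamily.formAux (K.comb b) a := by
  rw [KernelFamily.formAux_comb, KernelFamily.formAux_comb, Finsupp.sum_comm]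
  simp only [map_finsuppSum, map_mul, Complex.conj_conj, hK.form_conj]
  refine Finsupp.sum_congr fun x _ => Finsupp.sum_congr fun y _ => ?_
  ring

/-- The scalar product of `H^K_0`: if `F = ∑ a_j K_{η_j}` and `F' = ∑ b_l K_{ξ_l}`, then
`(F | F') = ∑ a_j \bar b_l (K(s_l^{-*}, t_j) η_j | ξ_l) = ∑ \bar b_l (F(s_l^{-*}) | ξ_l)`, where
`η_j ∈ D_{t_j}` and `ξ_l ∈ D_{s_l}`. As everywhere in Mathlib, the inner product `ip F' F` of `F'`
and `F` is linear in `F`, that is, it stands for `(F | F')`. -/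
def KernelFamily.ip {K : d.KernelFamily} (F' F : K.span₀) : ℂ :=
  KernelFamily.formAux (F : d.Sections) (KernelFamily.exists_comb F').choose

theorem IsReproducingKernel.ip_eq {K : d.KernelFamily} (hK : IsReproducingKernel K)
    {F' : K.span₀} {a : ((s : d.Base) × d.Fiber s) →₀ ℂ} (ha : K.comb a = F') (F : K.span₀) :
    KernelFamily.ip F' F = KernelFamily.formAux (F : d.Sections) a := by
  obtain ⟨b, hb⟩ := KernelFamily.exists_comb F
  rw [KernelFamily.ip, ← hb, ← hK.formAux_conj, ← hK.formAux_conj a b, ha,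
    (KernelFamily.exists_comb F').choose_spec]

theorem IsReproducingKernel.ip_sec₀ {K : d.KernelFamily} (hK : IsReproducingKernel K)
    {s : d.Base} (ξ : d.Fiber s) (F : K.span₀) :
    KernelFamily.ip (K.sec₀ ξ) F = pairing ((F : d.Sections) (d.inv s)) ξ := by
  rw [hK.ip_eq (a := Finsupp.single ⟨s, ξ⟩ 1)]
  · simp [KernelFamily.formAux]
  · simp [KernelFamily.comb, KernelFamily.sec₀]

/-- The scalar product of `H^K_0` is hermitian and positive semidefinite. -/
abbrev IsReproducingKernel.preCore {K : d.KernelFamily} (hK : IsReproducingKernel K) :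
    PreInnerProductSpace.Core ℂ K.span₀ where
  inner F' F := KernelFamily.ip F' F
  conj_inner_symm F F' := by
    obtain ⟨a, ha⟩ := KernelFamily.exists_comb F
    obtain ⟨b, hb⟩ := KernelFamily.exists_comb F'
    rw [hK.ip_eq ha, hK.ip_eq hb, ← ha, ← hb, hK.formAux_conj]
  re_inner_nonneg F := by
    obtain ⟨a, ha⟩ := KernelFamily.exists_comb F
    rw [hK.ip_eq ha, ← ha]
    exact (Complex.nonneg_iff.1 (hK.formAux_nonneg _)).1
  add_left F F' F'' := by
    obtain ⟨a, ha⟩ := KernelFamily.exists_comb F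
    obtain ⟨b, hb⟩ := KernelFamily.exists_comb F'
    have hab : K.comb (a + b) = (F + F' : K.span₀) := by
      rw [map_add, ha, hb]; rfl
    rw [hK.ip_eq ha, hK.ip_eq hb, hK.ip_eq hab]
    exact Finsupp.sum_add_index' (by simp) (by intros; rw [map_add, add_mul])
  smul_left F F' c := by
    obtain ⟨a, ha⟩ := KernelFamily.exists_comb F
    have hca : K.comb (c • a) = (c • F : K.span₀) := by
      rw [map_smul, ha]; rfl
    rw [hK.ip_eq ha, hK.ip_eq hca]
    simp only [KernelFamily.formAux]
    rw [Finsupp.sum_smul_index (by simp), Finsupp.mul_sum]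
    exact Finsupp.sum_congr fun x _ => by rw [map_mul, mul_assoc]

/-- The scalar product of `H^K_0` is an inner product. -/
abbrev IsReproducingKernel.core {K : d.KernelFamily} (hK : IsReproducingKernel K) :
    InnerProductSpace.Core ℂ K.span₀ where
  toCore := hK.preCore
  definite F hF := by
    refine Subtype.ext (funext fun s => ?_)
    obtain ⟨t, rfl⟩ := exists_inv_eq s
    refine pairing_nondegenerate _ fun ξ => ?_
    rw [← hK.ip_sec₀]
    have h := @InnerProductSpace.Core.inner_mul_inner_self_le ℂ _ _ _ _ hK.preCore F (K.sec₀ ξ)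
    change ‖KernelFamily.ip F (K.sec₀ ξ)‖ * ‖KernelFamily.ip (K.sec₀ ξ) F‖ ≤
      RCLike.re (KernelFamily.ip F F) * _ at h
    have h0 : KernelFamily.ip F F = 0 := hF
    have hc : conj (KernelFamily.ip (K.sec₀ ξ) F) = KernelFamily.ip F (K.sec₀ ξ) :=
      hK.preCore.conj_inner_symm F (K.sec₀ ξ)
    rw [h0, map_zero, zero_mul, ← hc, RCLike.norm_conj] at h
    exact norm_eq_zero.1 (mul_self_eq_zero.1 (le_antisymm h (mul_self_nonneg _)))

/-- The space `H^K_0` with the scalar product for which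
`(K_η | K_ξ) = (K(s^{-*}, t) η | ξ)_{s^{-*}, s}` (`ξ ∈ D_s`, `η ∈ D_t`). -/
def PreHilbert (K : d.KernelFamily) (_hK : IsReproducingKernel K) : Type _ := K.span₀

instance (K : d.KernelFamily) (hK : IsReproducingKernel K) :
    NormedAddCommGroup (PreHilbert K hK) :=
  @InnerProductSpace.Core.toNormedAddCommGroup ℂ K.span₀ _ _ _ hK.core

instance (K : d.KernelFamily) (hK : IsReproducingKernel K) :
    InnerProductSpace ℂ (PreHilbert K hK) :=
  @InnerProductSpace.ofCore ℂ K.span₀ _ _ _ hK.core.toCore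

/-- The reproducing `(-*)`-kernel Hilbert space `H^K`, the completion of `H^K_0`. -/
abbrev KernelHilbert (K : d.KernelFamily) (hK : IsReproducingKernel K) : Type _ :=
  UniformSpace.Completion (PreHilbert K hK)

/-- The embedding of `H^K_0` into `H^K` as a dense linear subspace. -/
def toKernelHilbert {K : d.KernelFamily} (hK : IsReproducingKernel K) :
    K.span₀ →ₗ[ℂ] KernelHilbert K hK where
  toFun F := ((show PreHilbert K hK from F) : KernelHilbert K hK)
  map_add' F F' := UniformSpace.Completion.coe_add (α := PreHilbert K hK) F F'
  map_smul' c F := UniformSpace.Completion.coe_smul (M := ℂ) (X := PreHilbert K hK) c F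

/-- The mapping `K̂ : D_s → H^K`, `K̂(ξ) = K_ξ`. -/
def khat {K : d.KernelFamily} (hK : IsReproducingKernel K) {s : d.Base} (ξ : d.Fiber s) :
    KernelHilbert K hK :=
  toKernelHilbert hK (K.sec₀ ξ)

/-- The defining property of the scalar product of `H^K`. -/
theorem inner_khat {K : d.KernelFamily} (hK : IsReproducingKernel K) {s t : d.Base}
    (ξ : d.Fiber s) (η : d.Fiber t) :
    inner ℂ (khat hK ξ) (khat hK η) = pairing (K (d.inv s) t η) ξ :=
  (UniformSpace.Completion.inner_coe (𝕜 := ℂ) (E := PreHilbert K hK) (K.sec₀ ξ) (K.sec₀ η)).trans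
    (hK.ip_sec₀ ξ (K.sec₀ η))

/-- `ι` is the canonical inclusion of `H^K` into the space of sections (the realization operator of
`K`): the injective linear map that is the identity on the dense subspace `H^K_0` and for which all
the evaluations `ev_s : h ↦ (ι h)(s)` are continuous. -/
structure IsCanonicalInclusion {K : d.KernelFamily} (hK : IsReproducingKernel K)
    (ι : KernelHilbert K hK →ₗ[ℂ] d.Sections) : Prop where
  apply_coe : ∀ F : K.span₀, ι (toKernelHilbert hK F) = F
  injective : Function.Injective ι
  continuous_eval : ∀ s, Continuous fun h => ι h s

/-- For a bounded linear operator `T : 𝓗 → D_t` on a Hilbert space, `S : D_{t^{-*}} → 𝓗` is the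
operator `T^{-*}`, that is, `(T h | y)_{t, t^{-*}} = (h | S y)` for all `h` and `y`. -/
def IsMinusStar {V : Type*} [NormedAddCommGroup V] [InnerProductSpace ℂ V] {t : d.Base}
    (T : V →L[ℂ] d.Fiber t) (S : d.Fiber (d.inv t) →L[ℂ] V) : Prop :=
  ∀ h y, pairing (T h) y = inner ℂ (S y) h

end RepresentationPair

end

/-! ### The reproducing kernel of a homogeneous bundle

The algebraic heart is the identity `RepresentationPair.pairing_γ`: with respect to the pairing of
`D_s` and `D_{s^{-*}}`, the operator `γ` is adjoint to `Θ`. It holds because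
`π_A(u^{-*})^* π_A(u) = 1`, so that the operators `π_A(u)` and `π_A(u^{-*})` that identify the two
fibres with `H_B` cancel against each other. Since `K_η = γ(Θ(η))` (`kernel_eq_γ`), it follows that
`(K_η | ξ) = (Θ(η) | Θ(ξ))`. This gives all that concerns the kernel: positivity; the kernel of `γ`,
which is the orthogonal complement of the span of the vectors `Θ(ξ)`; and the fact that `γ` is an
isometry of this span onto `H^K_0` (`γEquiv`, `ip_eq_inner`). The isometry `W` is the continuous
extension of its inverse, so `γ ∘ W` is the identity on `H^K_0`, and it is injective because `γ` is
injective on the closed span. The evaluation at `t` is `γEval t ∘ W`, and its `-*`-adjoint is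
`η ↦ K_η` on the fibre over `t^{-*}`, again by `pairing_γ`.

The quotient manifolds come from local sections of `G_A → G_A / G_B`. If `φ` is a chart at `1` in
which `G_B` is a complemented subspace, `P` a projection onto it, and `s` the inverse of `φ`
translated to `0`, then `v ↦ s (v - P v) * s (P v)` is a local diffeomorphism at `0` by the inverse
function theorem, and near `1` two points lie in the same coset if and only if their coordinates
`v - P v` agree (`exists_isSliceChart_one`). Left translates of this chart give coordinates `Q` and
local sections `σ` of the set of cosets everywhere, and `D` has the coordinates
`[(z, f)] ↦ (Q z, π_B(σ(Q z)⁻¹ z) f)`. A chart `e` of a quotient space `p : M → X` such that `e ∘ p`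
is smooth and `e⁻¹` lifts to a smooth map into `M` is compatible with any other such chart, which
yields the atlases (`nonempty_quotientManifold`). Smoothness of maps out of a quotient manifold is
checked upstairs, as submersions have smooth local sections (`contMDiffAt_of_comp_submersion`).

The charts of `D` and the smoothness of `γ h` need `π_A` to be smooth, while it is only assumed to
be continuous if `𝕜 = ℝ`. A continuous homomorphism `f` into a Banach algebra is Lipschitz at `1`:
for `x` near `1` and `n ∼ 1 / ‖x‖` the powers `x ^ j`, `j ≤ n`, stay near `1`, so that `f x ^ n - 1`,
which is comparable to `n (f x - 1)`, is bounded. Then `f - 1` is additive in a chart up to an error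
`O(‖x‖ ‖y‖)`, thus linear up to `O(‖x‖ ^ 2)` by Hyers–Ulam stability, that is, differentiable at `1`.
Finally, the derivative of `f` can be expressed by `f` and the group law, so `f` is smooth
(`contDiffOn_of_local_mul`).
-/

/-! ### Continuous local homomorphisms into a Banach algebra are differentiable -/

section LocalHomomorphism

open Filter Topology

variable {E A : Type*} [NormedAddCommGroup E]

/-- If `x, x * x, x * x * x, …` stay in a small ball for about `1 / ‖x‖` steps, then
`(f x ^ n - 1)` is bounded for `n ∼ 1 / ‖x‖`, while it is comparable to `n (f x - 1)`. -/
theorem eventually_norm_sub_one_le_of_local_mul [NormedRing A] [NormedAlgebra ℝ A]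
    {f : E → A} {m : E × E → E} (hf : ContinuousAt f 0) (hf0 : f 0 = 1)
    (hm : ∃ K : ℝ, ∀ᶠ p in 𝓝 (0 : E × E), ‖m p - p.1‖ ≤ K * ‖p.2‖)
    (hmul : ∀ᶠ p in 𝓝 (0 : E × E), f (m p) = f p.1 * f p.2) :
    ∃ C : ℝ, ∀ᶠ x in 𝓝 (0 : E), ‖f x - 1‖ ≤ C * ‖x‖ := by
  obtain ⟨K₀, hK₀⟩ := hm
  set K := max K₀ 1 with hKdef
  have hK1 : 1 ≤ K := le_max_right _ _
  have hfe : ∀ᶠ x in 𝓝 (0 : E), ‖f x - 1‖ < 1 / 2 := by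
    have := Metric.continuousAt_iff'.1 hf (1 / 2) (by norm_num)
    simpa [hf0, dist_eq_norm] using this
  obtain ⟨δ₁, hδ₁, h₁⟩ := Metric.eventually_nhds_iff.1 hfe
  obtain ⟨δ₂, hδ₂, h₂⟩ := Metric.eventually_nhds_iff.1 (hK₀.and hmul)
  set δ := min δ₁ δ₂
  have hδ : 0 < δ := lt_min hδ₁ hδ₂
  refine ⟨4 * K / δ, Metric.eventually_nhds_iff.2 ⟨δ / (4 * K), by positivity, fun x hx => ?_⟩⟩
  rw [dist_zero_right] at hx
  rcases eq_or_ne x 0 with rfl | hx0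
  · simp [hf0]
  have hxpos : 0 < ‖x‖ := norm_pos_iff.2 hx0
  have hxK : K * ‖x‖ < δ / 4 := by
    rw [lt_div_iff₀ (by positivity)] at hx
    linarith
  have hxδ : ‖x‖ < δ := by nlinarith
  set n := ⌊δ / (2 * (K * ‖x‖))⌋₊ with hn
  set y : ℕ → E := fun j => (fun z => m (z, x))^[j] 0 with hy
  have key : ∀ j ≤ n, ‖y j‖ ≤ j * (K * ‖x‖) ∧ f (y j) = f x ^ j := by
    intro j
    induction j with
    | zero => intro _; simp [hy, hf0]
    | succ j ih =>
      intro hj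
      obtain ⟨ih1, ih2⟩ := ih (by omega)
      have hjn : ((j + 1 : ℕ) : ℝ) * (2 * (K * ‖x‖)) ≤ δ :=
        (le_div_iff₀ (by positivity)).1 ((Nat.le_floor_iff (by positivity)).1 hj)
      push_cast at hjn
      have hyδ : ‖y j‖ < δ := by nlinarith
      have hp := h₂ (y := (y j, x)) (by
        rw [dist_zero_right, Prod.norm_def]
        exact (max_lt hyδ hxδ).trans_le (min_le_right _ _))
      have hsucc : y (j + 1) = m (y j, x) := Function.iterate_succ_apply' _ _ _
      refine ⟨?_, ?_⟩
      · have h3 : ‖m (y j, x) - y j‖ ≤ K * ‖x‖ :=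
          hp.1.trans (mul_le_mul_of_nonneg_right (le_max_left _ _) (norm_nonneg _))
        have h4 := norm_add_le (m (y j, x) - y j) (y j)
        rw [sub_add_cancel] at h4
        rw [hsucc]
        push_cast
        linarith
      · rw [hsucc, hp.2, ih2, pow_succ]
  have hpow : ∀ j ≤ n, ‖f x ^ j - 1‖ ≤ 1 / 2 := by
    intro j hj
    obtain ⟨k1, k2⟩ := key j hj
    rw [← k2]
    refine (h₁ ?_).le
    rw [dist_zero_right]
    have hjn : (j : ℝ) * (2 * (K * ‖x‖)) ≤ δ :=
      (le_div_iff₀ (by positivity)).1 ((Nat.le_floor_iff (by positivity)).1 hj)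
    have : δ ≤ δ₁ := min_le_left _ _
    nlinarith
  have hgeom : (n : ℝ) • (f x - 1) =
      (f x ^ n - 1) - ∑ j ∈ Finset.range n, (f x ^ j - 1) * (f x - 1) := by
    rw [← Finset.sum_mul, Finset.sum_sub_distrib, sub_mul, geom_sum_mul]
    simp [Nat.cast_smul_eq_nsmul]
  have hsum : ‖∑ j ∈ Finset.range n, (f x ^ j - 1) * (f x - 1)‖ ≤ n * (1 / 2 * ‖f x - 1‖) := by
    refine (norm_sum_le _ _).trans ?_
    refine (Finset.sum_le_card_nsmul _ _ (1 / 2 * ‖f x - 1‖) fun j hj => ?_).trans (by simp)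
    exact (norm_mul_le _ _).trans
      (mul_le_mul_of_nonneg_right (hpow j (Finset.mem_range.1 hj).le) (norm_nonneg _))
  have hle : n * ‖f x - 1‖ ≤ 1 := by
    have h5 := congrArg norm hgeom
    rw [norm_smul, Real.norm_natCast] at h5
    have h6 := norm_sub_le (f x ^ n - 1) (∑ j ∈ Finset.range n, (f x ^ j - 1) * (f x - 1))
    have h7 := hpow n le_rfl
    linarith
  have hnl : δ / (4 * (K * ‖x‖)) ≤ n := by
    have h8 := Nat.lt_floor_add_one (δ / (2 * (K * ‖x‖)))
    rw [← hn] at h8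
    have h9 : δ / (2 * (K * ‖x‖)) = 2 * (δ / (4 * (K * ‖x‖))) := by field_simp; norm_num
    have h10 : 1 ≤ δ / (4 * (K * ‖x‖)) := by
      rw [le_div_iff₀ (by positivity)]; linarith
    linarith
  have hfin : δ / (4 * (K * ‖x‖)) * ‖f x - 1‖ ≤ 1 :=
    (mul_le_mul_of_nonneg_right hnl (norm_nonneg _)).trans hle
  rw [div_mul_eq_mul_div, div_le_one (by positivity)] at hfin
  rw [div_mul_eq_mul_div, le_div_iff₀ hδ]
  linarith

/-- Hyers–Ulam stability: a locally Lipschitz-at-`0` map that is additive up to a quadratic error is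
linear up to a quadratic error. The linear map is `x ↦ lim 2 ^ k h (x / 2 ^ k)`. -/
theorem exists_continuousLinearMap_of_quadratic_additive [NormedSpace ℝ E] [NormedAddCommGroup A]
    [NormedSpace ℝ A] [CompleteSpace A] {h : E → A} {C δ : ℝ} (hδ : 0 < δ) (hC : 0 ≤ C)
    (hlin : ∀ x, ‖x‖ < δ → ‖h x‖ ≤ C * ‖x‖)
    (hadd : ∀ x y, ‖x‖ < δ → ‖y‖ < δ → ‖h (x + y) - h x - h y‖ ≤ C * (‖x‖ * ‖y‖)) :
    ∃ T : E →L[ℝ] A, ∀ x, ‖x‖ < δ → ‖h x - T x‖ ≤ C * ‖x‖ ^ 2 := by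
  set a : E → ℕ → A := fun x k => (2 : ℝ) ^ k • h (((2 : ℝ) ^ k)⁻¹ • x) with ha
  have hsm : ∀ (x : E) (k : ℕ), ‖((2 : ℝ) ^ k)⁻¹ • x‖ = ((2 : ℝ) ^ k)⁻¹ * ‖x‖ := fun x k => by
    rw [norm_smul, Real.norm_of_nonneg (by positivity)]
  have hev : ∀ x : E, ∀ᶠ k : ℕ in atTop, ‖((2 : ℝ) ^ k)⁻¹ • x‖ < δ := by
    intro x
    have h1 : Tendsto (fun k : ℕ => ((2 : ℝ) ^ k)⁻¹ * ‖x‖) atTop (𝓝 0) := by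
      have := (tendsto_inv_atTop_zero.comp
        (tendsto_pow_atTop_atTop_of_one_lt (one_lt_two (α := ℝ)))).mul_const ‖x‖
      simpa using this
    filter_upwards [h1.eventually (gt_mem_nhds hδ)] with k hk
    rwa [hsm]
  have hstep : ∀ x, ‖x‖ < δ → ∀ k, dist (a x k) (a x (k + 1)) ≤ C * ‖x‖ ^ 2 / 2 / 2 ^ k := by
    intro x hx k
    set y := ((2 : ℝ) ^ (k + 1))⁻¹ • x with hy
    have hyx : ‖y‖ = ((2 : ℝ) ^ (k + 1))⁻¹ * ‖x‖ := hsm x (k + 1)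
    have hyδ : ‖y‖ < δ := by
      rw [hyx]
      refine lt_of_le_of_lt ?_ hx
      exact mul_le_of_le_one_left (norm_nonneg _)
        (inv_le_one_of_one_le₀ (one_le_pow₀ one_le_two))
    have h2 : ((2 : ℝ) ^ k)⁻¹ • x = y + y := by
      rw [hy, ← two_smul ℝ, smul_smul]
      congr 1
      field_simp
      ring
    have h3 : a x k - a x (k + 1) = (2 : ℝ) ^ k • (h (y + y) - h y - h y) := by
      simp only [ha]
      rw [h2, pow_succ, mul_smul, ← smul_sub, two_smul, sub_sub]
      simp [hy, pow_succ]
    rw [dist_eq_norm, h3, norm_smul, Real.norm_of_nonneg (by positivity)]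
    refine (mul_le_mul_of_nonneg_left (hadd y y hyδ hyδ) (by positivity)).trans ?_
    rw [hyx, pow_succ, le_div_iff₀ (by positivity)]
    have h2k : (0 : ℝ) < 2 ^ k := by positivity
    field_simp
    nlinarith [mul_nonneg hC (sq_nonneg ‖x‖)]
  have hlim : ∀ x, ∃ L, Tendsto (a x) atTop (𝓝 L) := by
    intro x
    obtain ⟨k₀, hk₀⟩ := (hev x).exists
    set y := ((2 : ℝ) ^ k₀)⁻¹ • x with hy
    have hc := cauchySeq_of_le_geometric_two (hstep y hk₀)
    obtain ⟨L, hL⟩ := cauchySeq_tendsto_of_complete hc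
    refine ⟨(2 : ℝ) ^ k₀ • L, (tendsto_add_atTop_iff_nat k₀).1 ?_⟩
    refine (hL.const_smul ((2 : ℝ) ^ k₀)).congr fun k => ?_
    simp only [ha, hy, smul_smul, pow_add, mul_inv]
    rw [mul_comm ((2 : ℝ) ^ k₀)]
  choose T hT using hlim
  have hTadd : ∀ x y, T (x + y) = T x + T y := by
    intro x y
    have h1 : Tendsto (fun k => a (x + y) k - a x k - a y k) atTop (𝓝 0) := by
      have h2 : Tendsto (fun k : ℕ => C * (‖x‖ * ‖y‖) * ((2 : ℝ) ^ k)⁻¹) atTop (𝓝 0) := by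
        have := (tendsto_inv_atTop_zero.comp
          (tendsto_pow_atTop_atTop_of_one_lt (one_lt_two (α := ℝ)))).const_mul (C * (‖x‖ * ‖y‖))
        simpa using this
      refine squeeze_zero_norm' ?_ h2
      filter_upwards [hev x, hev y] with k hx hy
      have h3 : a (x + y) k - a x k - a y k = (2 : ℝ) ^ k •
          (h (((2 : ℝ) ^ k)⁻¹ • x + ((2 : ℝ) ^ k)⁻¹ • y) - h (((2 : ℝ) ^ k)⁻¹ • x) -
            h (((2 : ℝ) ^ k)⁻¹ • y)) := by
        simp only [ha, smul_add, smul_sub]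
      rw [h3, norm_smul, Real.norm_of_nonneg (by positivity)]
      refine (mul_le_mul_of_nonneg_left (hadd _ _ hx hy) (by positivity)).trans (le_of_eq ?_)
      rw [hsm, hsm]
      field_simp
    have h4 := tendsto_nhds_unique h1 (((hT (x + y)).sub (hT x)).sub (hT y))
    rw [sub_sub] at h4
    exact (sub_eq_zero.1 h4.symm)
  have hTb : ∀ x, ‖T x‖ ≤ C * ‖x‖ := by
    intro x
    refine le_of_tendsto (hT x).norm ?_
    filter_upwards [hev x] with k hk
    simp only [ha]
    rw [norm_smul, Real.norm_of_nonneg (by positivity)]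
    refine (mul_le_mul_of_nonneg_left (hlin _ hk) (by positivity)).trans (le_of_eq ?_)
    rw [hsm]
    field_simp
  let T' : E →+ A := AddMonoidHom.mk' T hTadd
  have hTc : Continuous T' := AddMonoidHomClass.continuous_of_bound T' C hTb
  refine ⟨T'.toRealLinearMap hTc, fun x hx => ?_⟩
  have h5 := dist_le_of_le_geometric_two_of_tendsto₀ (hstep x hx) (hT x)
  simpa [ha, dist_eq_norm, T'] using h5

/-- A `C ^ 2` map `r` with `r (x, 0) = 0` and `r (0, y) = y` is `(x, y) ↦ y` up to `O(‖x‖ ‖y‖)`, by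
the mean value inequality for `y ↦ r (x, y) - r (0, y)`. -/
theorem eventually_norm_sub_snd_le [NormedSpace ℝ E] {r : E × E → E} (hr : ContDiffAt ℝ 2 r 0)
    (hr0 : ∀ᶠ x in 𝓝 (0 : E), r (x, 0) = 0) (h0r : ∀ᶠ x in 𝓝 (0 : E), r (0, x) = x) :
    ∃ K : ℝ, 0 ≤ K ∧ ∀ᶠ p in 𝓝 (0 : E × E), ‖r p - p.2‖ ≤ K * (‖p.1‖ * ‖p.2‖) := by
  have hr1 : ContDiffAt ℝ 1 (fderiv ℝ r) 0 := hr.fderiv_right (by norm_num)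
  obtain ⟨K, t, ht, hK⟩ := hr1.exists_lipschitzOnWith
  have hd : ∀ᶠ p in 𝓝 (0 : E × E), DifferentiableAt ℝ r p := by
    filter_upwards [hr.eventually (by simp)] with p hp
    exact hp.differentiableAt (by simp)
  obtain ⟨δ₁, hδ₁, h₁⟩ := Metric.eventually_nhds_iff.1 (hd.and ht)
  obtain ⟨δ₂, hδ₂, h₂⟩ := Metric.eventually_nhds_iff.1 (hr0.and h0r)
  set δ := min δ₁ δ₂
  have hδ : 0 < δ := lt_min hδ₁ hδ₂
  refine ⟨K, K.2, Metric.eventually_nhds_iff.2 ⟨δ, hδ, fun p hp => ?_⟩⟩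
  rw [dist_zero_right, Prod.norm_def, max_lt_iff] at hp
  obtain ⟨x, y⟩ := p
  obtain ⟨hx, hy⟩ := hp
  dsimp only at hx hy ⊢
  have hmem : ∀ z : E × E, ‖z.1‖ < δ → ‖z.2‖ < δ → DifferentiableAt ℝ r z ∧ z ∈ t := by
    intro z h1 h2
    refine h₁ ?_
    rw [dist_zero_right, Prod.norm_def]
    exact (max_lt h1 h2).trans_le (min_le_left _ _)
  have hder : ∀ z ∈ Metric.ball (0 : E) δ, HasFDerivWithinAt (fun z => r (x, z) - r (0, z))
      ((fderiv ℝ r (x, z) - fderiv ℝ r (0, z)).comp (ContinuousLinearMap.inr ℝ E E))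
      (Metric.ball 0 δ) z := by
    intro z hz
    rw [mem_ball_zero_iff] at hz
    have e1 : HasFDerivAt (fun z => r (x, z)) _ z :=
      (hmem (x, z) hx hz).1.hasFDerivAt.comp z (hasFDerivAt_prodMk_right x z)
    have e2 : HasFDerivAt (fun z => r (0, z)) _ z :=
      (hmem (0, z) (by simpa) hz).1.hasFDerivAt.comp z (hasFDerivAt_prodMk_right 0 z)
    exact (e1.sub e2).hasFDerivWithinAt
  have hb : ∀ z ∈ Metric.ball (0 : E) δ,
      ‖(fderiv ℝ r (x, z) - fderiv ℝ r (0, z)).comp (ContinuousLinearMap.inr ℝ E E)‖ ≤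
        K * ‖x‖ := by
    intro z hz
    rw [mem_ball_zero_iff] at hz
    refine (ContinuousLinearMap.opNorm_comp_le _ _).trans ?_
    have h3 := hK.dist_le_mul _ (hmem (x, z) hx hz).2 _ (hmem (0, z) (by simpa) hz).2
    rw [dist_eq_norm, dist_eq_norm] at h3
    have h4 : ‖((x, z) : E × E) - (0, z)‖ = ‖x‖ := by simp [Prod.norm_def]
    rw [h4] at h3
    have h5 : ‖ContinuousLinearMap.inr ℝ E E‖ ≤ 1 :=
      ContinuousLinearMap.opNorm_le_bound _ zero_le_one fun z => by simp [Prod.norm_def]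
    calc _ ≤ (K * ‖x‖) * 1 := mul_le_mul h3 h5 (norm_nonneg _) (by positivity)
      _ = _ := mul_one _
  have h6 := (convex_ball (0 : E) δ).norm_image_sub_le_of_norm_hasFDerivWithin_le hder hb
    (Metric.mem_ball_self hδ) (mem_ball_zero_iff.2 hy)
  have hx2 : ‖x‖ < δ₂ := hx.trans_le (min_le_right _ _)
  have hy2 : ‖y‖ < δ₂ := hy.trans_le (min_le_right _ _)
  have e1 := (h₂ (y := x) (by simpa using hx2)).1
  have e2 := (h₂ (y := y) (by simpa using hy2)).2
  have e3 := (h₂ (y := (0 : E)) (by simpa using hδ₂)).1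
  simp only [e1, e2, e3, sub_zero] at h6
  rwa [mul_assoc] at h6

/-- A map `f` into a Banach algebra that is continuous at `0` and turns a local group law `m` on a
normed space into the product is differentiable at `0`. Here `r (x, y)` stands for `x⁻¹ (x + y)`. -/
theorem differentiableAt_of_local_mul [NormedSpace ℝ E] [NormedRing A] [NormedAlgebra ℝ A]
    [CompleteSpace A] {f : E → A} {m r : E × E → E} (hf : ContinuousAt f 0) (hf0 : f 0 = 1)
    (hm : ContDiffAt ℝ 1 m 0) (hm0 : ∀ᶠ x in 𝓝 (0 : E), m (x, 0) = x)
    (hmul : ∀ᶠ p in 𝓝 (0 : E × E), f (m p) = f p.1 * f p.2)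
    (hr : ContDiffAt ℝ 2 r 0) (hr0 : ∀ᶠ x in 𝓝 (0 : E), r (x, 0) = 0)
    (h0r : ∀ᶠ x in 𝓝 (0 : E), r (0, x) = x)
    (hadd : ∀ᶠ p in 𝓝 (0 : E × E), f (p.1 + p.2) = f p.1 * f (r p)) :
    DifferentiableAt ℝ f 0 := by
  have hmK : ∃ K : ℝ, ∀ᶠ p in 𝓝 (0 : E × E), ‖m p - p.1‖ ≤ K * ‖p.2‖ := by
    obtain ⟨K, t, ht, hK⟩ := hm.exists_lipschitzOnWith
    refine ⟨K, ?_⟩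
    have hc : Tendsto (fun p : E × E => (p.1, (0 : E))) (𝓝 0) (𝓝 0) := by
      have : Continuous fun p : E × E => (p.1, (0 : E)) := by fun_prop
      exact this.tendsto' _ _ rfl
    have hc' : Tendsto (fun p : E × E => p.1) (𝓝 0) (𝓝 0) := by
      simpa using (continuous_fst (X := E) (Y := E)).tendsto 0
    filter_upwards [ht, hc.eventually ht, hc'.eventually hm0] with p h1 h2 h3
    have h4 := hK.dist_le_mul _ h1 _ h2
    rw [h3, dist_eq_norm, dist_eq_norm] at h4
    have h5 : ‖p - (p.1, 0)‖ = ‖p.2‖ := by simp [Prod.norm_def]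
    rwa [h5] at h4
  obtain ⟨C, hC⟩ := eventually_norm_sub_one_le_of_local_mul hf hf0 hmK hmul
  obtain ⟨K, hK0, hK⟩ := eventually_norm_sub_snd_le hr hr0 h0r
  have hr00 : r 0 = 0 := hr0.self_of_nhds
  have hrt : Tendsto r (𝓝 0) (𝓝 0) := by simpa [hr00] using hr.continuousAt.tendsto
  obtain ⟨δ₁, hδ₁, h₁⟩ := Metric.eventually_nhds_iff.1 hC
  obtain ⟨δ₂, hδ₂, h₂⟩ := Metric.eventually_nhds_iff.1
    ((hK.and hadd).and (hrt.eventually hC))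
  -- `C'` bounds the growth of `f - 1`, and `M` is a Lipschitz constant of `f` near `0`.
  set C' := max C 0
  have hC'0 : 0 ≤ C' := le_max_right _ _
  set δ₀ := min (min δ₁ δ₂) 1
  have hδ₀ : 0 < δ₀ := lt_min (lt_min hδ₁ hδ₂) one_pos
  have hl : ∀ x, ‖x‖ < δ₀ → ‖f x - 1‖ ≤ C' * ‖x‖ := by
    intro x hx
    refine (h₁ ?_).trans (mul_le_mul_of_nonneg_right (le_max_left _ _) (norm_nonneg _))
    rw [dist_zero_right]
    exact hx.trans_le ((min_le_left _ _).trans (min_le_left _ _))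
  have hp : ∀ x y, ‖x‖ < δ₀ → ‖y‖ < δ₀ → ‖r (x, y) - y‖ ≤ K * (‖x‖ * ‖y‖) ∧
      f (x + y) = f x * f (r (x, y)) ∧ ‖f (r (x, y)) - 1‖ ≤ C' * ‖r (x, y)‖ := by
    intro x y hx hy
    have := h₂ (y := (x, y)) (by
      rw [dist_zero_right, Prod.norm_def]
      exact (max_lt hx hy).trans_le ((min_le_left _ _).trans (min_le_right _ _)))
    exact ⟨this.1.1, this.1.2,
      this.2.trans (mul_le_mul_of_nonneg_right (le_max_left _ _) (norm_nonneg _))⟩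
  set N := ‖(1 : A)‖
  have hN : 0 ≤ N := norm_nonneg _
  have hfb : ∀ x, ‖x‖ < δ₀ → ‖f x‖ ≤ C' + N := by
    intro x hx
    have e1 := norm_add_le (f x - 1) 1
    rw [sub_add_cancel] at e1
    have e2 := hl x hx
    have e3 : ‖x‖ < 1 := hx.trans_le (min_le_right _ _)
    have e4 : C' * ‖x‖ ≤ C' := by nlinarith
    linarith
  have hrb : ∀ x y, ‖x‖ < δ₀ → ‖y‖ < δ₀ → ‖r (x, y)‖ ≤ (K + 1) * ‖y‖ := by
    intro x y hx hy
    have e1 := norm_add_le (r (x, y) - y) y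
    rw [sub_add_cancel] at e1
    have e2 := (hp x y hx hy).1
    have e3 : ‖x‖ < 1 := hx.trans_le (min_le_right _ _)
    have e5 : ‖x‖ * ‖y‖ ≤ ‖y‖ := by nlinarith [norm_nonneg y]
    have e4 : K * (‖x‖ * ‖y‖) ≤ K * ‖y‖ := mul_le_mul_of_nonneg_left e5 hK0
    linarith
  set M := (C' + N) * (C' * (K + 1))
  have hM : 0 ≤ M := by positivity
  have hLip : ∀ x y, ‖x‖ < δ₀ → ‖y‖ < δ₀ → ‖f (x + y) - f x‖ ≤ M * ‖y‖ := by
    intro x y hx hy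
    obtain ⟨-, e2, e3⟩ := hp x y hx hy
    have e4 : f (x + y) - f x = f x * (f (r (x, y)) - 1) := by rw [e2, mul_sub, mul_one]
    rw [e4]
    refine (norm_mul_le _ _).trans ?_
    calc _ ≤ (C' + N) * (C' * ((K + 1) * ‖y‖)) :=
          mul_le_mul (hfb x hx) (e3.trans (mul_le_mul_of_nonneg_left (hrb x y hx hy) hC'0))
            (norm_nonneg _) (by positivity)
      _ = _ := by ring
  set δ := δ₀ / (K + 1)
  have hδ : 0 < δ := by positivity
  have hδδ₀ : δ ≤ δ₀ := div_le_self hδ₀.le (by linarith)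
  have hKδ : K * δ < δ₀ := by
    have e1 : (K + 1) * δ = δ₀ := mul_div_cancel₀ _ (by positivity)
    nlinarith
  set C₁ := M * K + C' * (C' * (K + 1))
  have hadd' : ∀ x y, ‖x‖ < δ → ‖y‖ < δ →
      ‖(f (x + y) - 1) - (f x - 1) - (f y - 1)‖ ≤ C₁ * (‖x‖ * ‖y‖) := by
    intro x y hx' hy'
    have hx := hx'.trans_le hδδ₀
    have hy := hy'.trans_le hδδ₀
    obtain ⟨e1, e2, e3⟩ := hp x y hx hy
    have e4 : (f (x + y) - 1) - (f x - 1) - (f y - 1) =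
        (f (r (x, y)) - f y) + (f x - 1) * (f (r (x, y)) - 1) := by
      rw [e2]; noncomm_ring
    have e5 : ‖f (r (x, y)) - f y‖ ≤ M * (K * (‖x‖ * ‖y‖)) := by
      have e6 : ‖r (x, y) - y‖ < δ₀ := by
        refine e1.trans_lt ?_
        have e7 : ‖x‖ < 1 := hx.trans_le (min_le_right _ _)
        have e8 : ‖x‖ * ‖y‖ ≤ δ := by nlinarith [norm_nonneg y]
        exact (mul_le_mul_of_nonneg_left e8 hK0).trans_lt hKδ
      have e9 := hLip y (r (x, y) - y) hy e6
      rw [add_sub_cancel] at e9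
      exact e9.trans (mul_le_mul_of_nonneg_left e1 hM)
    have e10 : ‖(f x - 1) * (f (r (x, y)) - 1)‖ ≤ (C' * ‖x‖) * (C' * ((K + 1) * ‖y‖)) :=
      (norm_mul_le _ _).trans (mul_le_mul (hl x hx)
        (e3.trans (mul_le_mul_of_nonneg_left (hrb x y hx hy) hC'0)) (norm_nonneg _)
        (by positivity))
    rw [e4]
    refine (norm_add_le _ _).trans ((add_le_add e5 e10).trans (le_of_eq ?_))
    simp only [C₁]
    ring
  obtain ⟨T, hT⟩ := exists_continuousLinearMap_of_quadratic_additive (h := fun x => f x - 1)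
    (C := max C' C₁) hδ (hC'0.trans (le_max_left _ _))
    (fun x hx => (hl x (hx.trans_le hδδ₀)).trans
      (mul_le_mul_of_nonneg_right (le_max_left _ _) (norm_nonneg _)))
    (fun x y hx hy => (hadd' x y hx hy).trans
      (mul_le_mul_of_nonneg_right (le_max_right _ _) (by positivity)))
  refine HasFDerivAt.differentiableAt (f' := T) ?_
  rw [hasFDerivAt_iff_isLittleO_nhds_zero]
  have hO : (fun x => f (0 + x) - f 0 - T x) =O[𝓝 0] fun x : E => ‖x‖ ^ 2 := by
    refine Asymptotics.IsBigO.of_bound (max C' C₁) ?_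
    filter_upwards [Metric.ball_mem_nhds (0 : E) hδ] with x hx
    have := hT x (by simpa using hx)
    simpa [hf0] using this
  refine hO.trans_isLittleO ?_
  have h1 : (fun x : E => ‖x‖ ^ 2) =o[𝓝 0] fun x : E => ‖x‖ ^ 1 :=
    Asymptotics.isLittleO_norm_pow_norm_pow one_lt_two
  simp only [pow_one] at h1
  exact h1.of_norm_right

end LocalHomomorphism

section Bootstrap

open Filter Topology

/-- Smoothness of a homomorphism by bootstrapping: if `f z = f x * f (r (x, z))` (`r (x, z)` stands
for `x⁻¹ z`) and `f` is differentiable at the unit element `a`, then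
`f' x = f x * (f' a ∘ ∂₂ r (x, x))`, so that `f'` is as smooth as `f`. -/
theorem contDiffOn_of_local_mul {𝕜 E A : Type*} [RCLike 𝕜] [NormedAddCommGroup E]
    [NormedSpace 𝕜 E] [NormedRing A] [NormedAlgebra 𝕜 A] {f : E → A} {r : E × E → E} {U : Set E}
    {a : E} (hU : IsOpen U) (hr : ∀ x ∈ U, ContDiffAt 𝕜 ∞ r (x, x)) (hra : ∀ x ∈ U, r (x, x) = a)
    (ha : DifferentiableAt 𝕜 f a)
    (hmul : ∀ x ∈ U, ∀ᶠ z in 𝓝 x, f z = f x * f (r (x, z))) :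
    ContDiffOn 𝕜 ∞ f U := by
  have hder : ∀ x ∈ U, HasFDerivAt f ((ContinuousLinearMap.mul 𝕜 A (f x)).comp
      ((fderiv 𝕜 f a).comp ((fderiv 𝕜 r (x, x)).comp (ContinuousLinearMap.inr 𝕜 E E)))) x := by
    intro x hx
    have h1 : HasFDerivAt (fun z => r (x, z)) _ x :=
      ((hr x hx).differentiableAt (by simp)).hasFDerivAt.comp x (hasFDerivAt_prodMk_right x x)
    have h2 : HasFDerivAt f (fderiv 𝕜 f a) (r (x, x)) := by
      rw [hra x hx]; exact ha.hasFDerivAt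
    have h3 := (ContinuousLinearMap.mul 𝕜 A (f x)).hasFDerivAt.comp x (h2.comp x h1)
    exact h3.congr_of_eventuallyEq (hmul x hx)
  have hD : ContDiffOn 𝕜 ∞ (fun x => fderiv 𝕜 r (x, x)) U := by
    intro x hx
    have h1 : ContDiffAt 𝕜 ∞ (fderiv 𝕜 r) (x, x) := (hr x hx).fderiv_right (by simp)
    exact (h1.comp (f := fun x : E => (x, x)) x
      (contDiffAt_id.prodMk contDiffAt_id)).contDiffWithinAt
  refine contDiffOn_infty.2 fun n => ?_
  induction n with
  | zero =>
    exact contDiffOn_zero.2 fun x hx => (hder x hx).continuousAt.continuousWithinAt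
  | succ n ih =>
    push_cast
    rw [contDiffOn_succ_iff_fderiv_of_isOpen hU]
    refine ⟨fun x hx => (hder x hx).differentiableAt.differentiableWithinAt, by simp, ?_⟩
    refine ContDiffOn.congr ?_ fun x hx => (hder x hx).fderiv
    have hDn : ContDiffOn 𝕜 n (fun x => fderiv 𝕜 r (x, x)) U := hD.of_le (by exact_mod_cast le_top)
    exact ((ContinuousLinearMap.mul 𝕜 A).contDiff.comp_contDiffOn ih).clm_comp
      (contDiffOn_const.clm_comp (hDn.clm_comp contDiffOn_const))

end Bootstrap

/-! ### Smoothness of norm-continuous representations -/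

section LieGroupHom

open Filter Topology

variable {𝕜 : Type*} [RCLike 𝕜] {E : Type*} [NormedAddCommGroup E] [NormedSpace 𝕜 E]
  {G : Type*} [Group G] [TopologicalSpace G] [ChartedSpace E G] [LieGroup 𝓘(𝕜, E) ∞ G]
  {A : Type*} [NormedRing A]

/-- A homomorphism of a Lie group into a normed algebra that is differentiable at the unit element
is smooth. -/
theorem contMDiff_of_mdifferentiableAt_one [NormedAlgebra 𝕜 A] (ρ : G →* A)
    (hρ : MDifferentiableAt 𝓘(𝕜, E) 𝓘(𝕜, A) ρ 1) : ContMDiff 𝓘(𝕜, E) 𝓘(𝕜, A) ∞ ρ := by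
  have := topologicalGroup_of_lieGroup 𝓘(𝕜, E) ∞ (G := G)
  have : IsManifold 𝓘(𝕜, E) ∞ G := ContMDiffMul.toIsManifold
  set φ := chartAt E (1 : G)
  have hφ : φ ∈ IsManifold.maximalAtlas 𝓘(𝕜, E) ∞ G := IsManifold.chart_mem_maximalAtlas 1
  have h1 : (1 : G) ∈ φ.source := mem_chart_source E 1
  have hs : ∀ x ∈ φ.target, ContMDiffAt 𝓘(𝕜, E) 𝓘(𝕜, E) ∞ φ.symm x := fun x hx =>
    contMDiffAt_symm_of_mem_maximalAtlas hφ hx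
  have hφ1 : ContMDiffAt 𝓘(𝕜, E) 𝓘(𝕜, E) ∞ φ 1 := contMDiffAt_of_mem_maximalAtlas hφ h1
  have hf : ContDiffOn 𝕜 ∞ (fun x => ρ (φ.symm x)) φ.target := by
    refine contDiffOn_of_local_mul (r := fun p => φ ((φ.symm p.1)⁻¹ * φ.symm p.2)) (a := φ 1)
      φ.open_target ?_ ?_ ?_ ?_
    · intro x hx
      refine contMDiffAt_iff_contDiffAt.1 ?_
      have e1 : ContMDiffAt 𝓘(𝕜, E × E) 𝓘(𝕜, E) ∞ (fun p : E × E => φ.symm p.1) (x, x) :=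
        ContMDiffAt.comp (x, x) (hs x hx) contDiff_fst.contMDiff.contMDiffAt
      have e2 : ContMDiffAt 𝓘(𝕜, E × E) 𝓘(𝕜, E) ∞ (fun p : E × E => φ.symm p.2) (x, x) :=
        ContMDiffAt.comp (x, x) (hs x hx) contDiff_snd.contMDiff.contMDiffAt
      refine ContMDiffAt.comp (x, x) (g := φ) ?_ (e1.inv.mul e2)
      simpa using hφ1
    · intro x hx
      simp
    · refine mdifferentiableAt_iff_differentiableAt.1 ?_
      refine MDifferentiableAt.comp (φ 1) (g := ρ) ?_
        ((hs _ (φ.map_source h1)).mdifferentiableAt (by simp))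
      rwa [φ.left_inv h1]
    · intro x hx
      have e1 : ContinuousAt (fun z => (φ.symm x)⁻¹ * φ.symm z) x :=
        continuousAt_const.mul (φ.symm.continuousAt hx)
      have e2 : ∀ᶠ z in 𝓝 x, (φ.symm x)⁻¹ * φ.symm z ∈ φ.source :=
        e1.eventually (φ.open_source.mem_nhds (by simpa using h1))
      filter_upwards [e2] with z hz
      rw [φ.left_inv hz, ← map_mul, mul_inv_cancel_left]
  have hρ1 : ContMDiffAt 𝓘(𝕜, E) 𝓘(𝕜, A) ∞ ρ 1 := by
    have e1 : ContMDiffAt 𝓘(𝕜, E) 𝓘(𝕜, A) ∞ ((fun x => ρ (φ.symm x)) ∘ φ) 1 :=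
      ContMDiffAt.comp 1
        ((hf.contDiffAt (φ.open_target.mem_nhds (φ.map_source h1))).contMDiffAt) hφ1
    refine e1.congr_of_eventuallyEq ?_
    filter_upwards [φ.open_source.mem_nhds h1] with x hx
    simp [φ.left_inv hx]
  intro g
  have e2 : (ρ : G → A) = fun x => ContinuousLinearMap.mul 𝕜 A (ρ g) (ρ (g⁻¹ * x)) := by
    funext x
    simp [← map_mul]
  rw [e2]
  refine ContMDiffAt.comp g (ContinuousLinearMap.mul 𝕜 A (ρ g)).contDiff.contMDiff.contMDiffAt ?_
  refine ContMDiffAt.comp g (g := ρ) ?_ contMDiffAt_mul_left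
  simpa using hρ1

/-- A continuous homomorphism of a Banach–Lie group into a real Banach algebra is differentiable
at the unit element, when it is read in the chart there. -/
theorem differentiableAt_of_continuous_monoidHom [NormedSpace ℝ E] [IsScalarTower ℝ 𝕜 E]
    [NormedAlgebra ℝ A] [CompleteSpace A] (ρ : G →* A) (hρ : Continuous ρ) :
    DifferentiableAt ℝ (fun x => ρ ((chartAt E (1 : G)).symm (chartAt E (1 : G) 1 + x))) 0 := by
  have := topologicalGroup_of_lieGroup 𝓘(𝕜, E) ∞ (G := G)
  have : IsManifold 𝓘(𝕜, E) ∞ G := ContMDiffMul.toIsManifold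
  set φ := chartAt E (1 : G)
  have hφ : φ ∈ IsManifold.maximalAtlas 𝓘(𝕜, E) ∞ G := IsManifold.chart_mem_maximalAtlas 1
  have h1 : (1 : G) ∈ φ.source := mem_chart_source E 1
  set a := φ 1
  have ha : a ∈ φ.target := φ.map_source h1
  have hsa : φ.symm a = 1 := φ.left_inv h1
  have hs : ContMDiffAt 𝓘(𝕜, E) 𝓘(𝕜, E) ∞ φ.symm a :=
    contMDiffAt_symm_of_mem_maximalAtlas hφ ha
  have hφ1 : ContMDiffAt 𝓘(𝕜, E) 𝓘(𝕜, E) ∞ φ 1 := contMDiffAt_of_mem_maximalAtlas hφ h1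
  -- `σ` is the inverse of the chart, translated so that `σ 0 = 1`.
  set σ : E → G := fun x => φ.symm (a + x) with hσ
  have hσ0 : σ 0 = 1 := by simp [hσ, hsa]
  have hσs : ContMDiffAt 𝓘(𝕜, E) 𝓘(𝕜, E) ∞ σ 0 := by
    refine ContMDiffAt.comp 0 (g := φ.symm) (by simpa using hs) ?_
    exact (contDiff_const.add contDiff_id).contMDiff.contMDiffAt
  have hσp : ∀ u : E × E →L[𝕜] E, ContMDiffAt 𝓘(𝕜, E × E) 𝓘(𝕜, E) ∞ (fun p => σ (u p)) 0 :=
    fun u => ContMDiffAt.comp 0 (g := σ) (by simpa using hσs) u.contDiff.contMDiff.contMDiffAt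
  have hlog : ∀ w : E × E → G, ContMDiffAt 𝓘(𝕜, E × E) 𝓘(𝕜, E) ∞ w 0 → w 0 = 1 →
      ContDiffAt ℝ ∞ (fun p => φ (w p) - a) 0 ∧
        ∀ᶠ p in 𝓝 0, σ (φ (w p) - a) = w p := by
    intro w hw hw0
    refine ⟨?_, ?_⟩
    · have e1 : ContMDiffAt 𝓘(𝕜, E × E) 𝓘(𝕜, E) ∞ (fun p => φ (w p)) 0 :=
        ContMDiffAt.comp 0 (g := φ) (by simpa [hw0] using hφ1) hw
      exact ((contMDiffAt_iff_contDiffAt.1 e1).sub contDiffAt_const).restrict_scalars ℝ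
    · filter_upwards [hw.continuousAt.eventually (φ.open_source.mem_nhds (by rwa [hw0]))] with p hp
      simp [hσ, φ.left_inv hp]
  have hσinv : ∀ᶠ x in 𝓝 (0 : E), φ (σ x) - a = x := by
    have e1 : ContinuousAt (fun x => a + x) 0 := by fun_prop
    filter_upwards [e1.eventually (φ.open_target.mem_nhds (by simpa using ha))] with x hx
    simp [hσ, φ.right_inv hx]
  let fst := ContinuousLinearMap.fst 𝕜 E E
  let snd := ContinuousLinearMap.snd 𝕜 E E
  obtain ⟨m1, m2⟩ := hlog (fun p => σ p.1 * σ p.2) ((hσp fst).mul (hσp snd)) (by simp [hσ0])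
  obtain ⟨r1, r2⟩ := hlog (fun p => (σ p.1)⁻¹ * σ (p.1 + p.2))
    ((hσp fst).inv.mul (hσp (fst + snd))) (by simp [hσ0])
  refine differentiableAt_of_local_mul (f := fun x => ρ (σ x))
    (m := fun p => φ (σ p.1 * σ p.2) - a) (r := fun p => φ ((σ p.1)⁻¹ * σ (p.1 + p.2)) - a)
    (hρ.continuousAt.comp hσs.continuousAt) (by simp [hσ0]) (m1.of_le (by simp)) ?_ ?_
    (r1.of_le (WithTop.coe_le_coe.2 (le_top : (2 : ℕ∞) ≤ ⊤))) ?_ ?_ ?_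
  · filter_upwards [hσinv] with x hx
    simp [hσ0, hx]
  · filter_upwards [m2] with p hp
    rw [hp, map_mul]
  · refine Eventually.of_forall fun x => ?_
    simp [a]
  · filter_upwards [hσinv] with x hx
    simp [hσ0, hx]
  · filter_upwards [r2] with p hp
    rw [hp, ← map_mul, mul_inv_cancel_left]

/-- The algebra structure of `ℂ` over `𝕜` is arbitrary, but its restriction to `ℝ ⊆ 𝕜` is the usual
one, because a continuous additive map is `ℝ`-linear. -/
theorem algebraMap_ofReal_complex [NormedAlgebra 𝕜 ℂ] (r : ℝ) :
    algebraMap 𝕜 ℂ (r : 𝕜) = (r : ℂ) := by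
  let f : ℝ →+ ℂ := (algebraMap 𝕜 ℂ).toAddMonoidHom.comp (RCLike.ofRealAm (K := 𝕜)).toAddMonoidHom
  have hf : Continuous f := (continuous_algebraMap 𝕜 ℂ).comp RCLike.continuous_ofReal
  have h := map_real_smul f hf r 1
  simpa [f] using h

end LieGroupHom

noncomputable section

namespace RepresentationPair

variable {𝕜 : Type*} [RCLike 𝕜] [NormedAlgebra 𝕜 ℂ]
    {E : Type*} [NormedAddCommGroup E] [NormedSpace 𝕜 E]
    [NormedSpace ℝ E] [IsScalarTower ℝ 𝕜 E]
    {G : Type*} [Group G] [StarMul G] [TopologicalSpace G] [ChartedSpace E G]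
    [LieGroup 𝓘(𝕜, E) ∞ G]
    {H : Type*} [NormedAddCommGroup H] [InnerProductSpace ℂ H] [CompleteSpace H]
    [NormedSpace 𝕜 H] [IsScalarTower 𝕜 ℂ H]
    (d : RepresentationPair G H)

/-- A norm-continuous representation is smooth over `𝕜` (if `𝕜` is complex, it has to be
holomorphic to begin with). -/
theorem contMDiff_π (hcont : Continuous d.π)
    (hhol : (RCLike.I : 𝕜) ≠ 0 → MDifferentiable 𝓘(𝕜, E) 𝓘(𝕜, H →L[ℂ] H) d.π) :
    ContMDiff 𝓘(𝕜, E) 𝓘(𝕜, H →L[ℂ] H) ∞ d.π := by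
  let : NormedAlgebra 𝕜 (H →L[ℂ] H) :=
    { Algebra.ofModule (R := 𝕜) (A := H →L[ℂ] H) (fun c f g => by ext x; simp)
        (fun c f g => by
          ext x
          change f (c • g x) = c • f (g x)
          rw [← algebraMap_smul ℂ c (g x), map_smul, algebraMap_smul]) with
      norm_smul_le := fun c f => norm_smul_le c f }
  refine contMDiff_of_mdifferentiableAt_one d.π ?_
  by_cases hI : (RCLike.I : 𝕜) = 0
  · have : IsManifold 𝓘(𝕜, E) ∞ G := ContMDiffMul.toIsManifold
    have hdiff := differentiableAt_of_continuous_monoidHom (𝕜 := 𝕜) (E := E) d.π hcont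
    set φ := chartAt E (1 : G)
    have h1 : (1 : G) ∈ φ.source := mem_chart_source E 1
    -- If `I = 0` in `𝕜`, every scalar is real.
    have hre : ∀ c : 𝕜, ((RCLike.re c : ℝ) : 𝕜) = c := fun c => by
      conv_rhs => rw [← RCLike.re_add_im c, hI, mul_zero, add_zero]
    obtain ⟨T, hT⟩ := hdiff
    let T' : E →L[𝕜] (H →L[ℂ] H) :=
      { toFun := T
        map_add' := T.map_add
        map_smul' := fun c x => by
          have e1 : c • x = (RCLike.re c : ℝ) • x := by
            conv_lhs => rw [← hre c]
            rw [← algebraMap_smul 𝕜 (RCLike.re c : ℝ) x]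
          rw [e1, map_smul, RingHom.id_apply]
          ext y
          conv_rhs => rw [← hre c]
          simp only [smul_apply]
          rw [← algebraMap_smul ℂ ((RCLike.re c : ℝ) : 𝕜) (T x y), algebraMap_ofReal_complex]
          rfl
        cont := T.cont }
    have hT' : HasFDerivAt (fun x => d.π (φ.symm (φ 1 + x))) T' 0 :=
      HasFDerivAt.of_isLittleO hT.isLittleO
    have e2 : DifferentiableAt 𝕜 (fun x => d.π (φ.symm x)) (φ 1) := by
      have e3 : DifferentiableAt 𝕜 (fun x => d.π (φ.symm (φ 1 + x))) (φ 1 - φ 1) := by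
        rw [sub_self]; exact hT'.differentiableAt
      have e4 := e3.comp (φ 1) (f := fun x => x - φ 1) (differentiableAt_id.sub_const _)
      simpa [Function.comp_def] using e4
    have e5 : MDifferentiableAt 𝓘(𝕜, E) 𝓘(𝕜, H →L[ℂ] H) ((fun x => d.π (φ.symm x)) ∘ φ) 1 :=
      MDifferentiableAt.comp 1 e2.mdifferentiableAt
        ((contMDiffAt_of_mem_maximalAtlas (n := ∞) (IsManifold.chart_mem_maximalAtlas 1)
          h1).mdifferentiableAt (by simp))
    refine e5.congr_of_eventuallyEq ?_
    filter_upwards [φ.open_source.mem_nhds h1] with x hx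
    simp [φ.left_inv hx]
  · exact hhol hI 1

end RepresentationPair

end

/-! ### Quotient manifolds from smooth local sections -/

section QuotientCharts

open Set Topology

universe w

variable {𝕜 : Type*} [NontriviallyNormedField 𝕜] {E : Type*} [NormedAddCommGroup E]
  [NormedSpace 𝕜 E] {H : Type*} [TopologicalSpace H] {I : ModelWithCorners 𝕜 E H}
  {M : Type*} [TopologicalSpace M] [ChartedSpace H M]
  {X : Type*} [TopologicalSpace X] {p : M → X}
  {N : Type w} [NormedAddCommGroup N] [NormedSpace 𝕜 N]

variable (I p) in
/-- A chart `e` of the topological space `X` is a quotient chart for `p : M → X` if `e ∘ p` is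
smooth and the inverse of `e` lifts to a smooth map into `M`. Any two quotient charts are
compatible. -/
structure IsQuotientChart (e : OpenPartialHomeomorph X N) : Prop where
  contMDiffOn_comp : ContMDiffOn I 𝓘(𝕜, N) ∞ (e ∘ p) (p ⁻¹' e.source)
  exists_lift : ∃ σ : N → M, ContMDiffOn 𝓘(𝕜, N) I ∞ σ e.target ∧ ∀ y ∈ e.target, p (σ y) = e.symm y

/-- In terms of the lift `σ` of the inverse of `e`, the coordinate change is `e' ∘ p ∘ σ`. -/
theorem IsQuotientChart.contDiffOn_coordChange {e e' : OpenPartialHomeomorph X N}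
    (he : IsQuotientChart I p e) (he' : IsQuotientChart I p e') :
    ContDiffOn 𝕜 ∞ (e.symm ≫ₕ e') (e.symm ≫ₕ e').source := by
  obtain ⟨σ, hσ, hpσ⟩ := he.exists_lift
  rw [← contMDiffOn_iff_contDiffOn]
  have hsub : ∀ y ∈ (e.symm ≫ₕ e').source, y ∈ e.target ∧ e.symm y ∈ e'.source := by
    intro y hy
    simpa using hy
  have h1 : ContMDiffOn 𝓘(𝕜, N) 𝓘(𝕜, N) ∞ ((e' ∘ p) ∘ σ) (e.symm ≫ₕ e').source :=
    he'.contMDiffOn_comp.comp (hσ.mono fun y hy => (hsub y hy).1) fun y hy => by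
      rw [mem_preimage, mem_preimage, hpσ y (hsub y hy).1]
      exact (hsub y hy).2
  refine h1.congr fun y hy => ?_
  simp [hpσ y (hsub y hy).1]

theorem IsQuotientChart.coordChange_mem_groupoid {e e' : OpenPartialHomeomorph X N}
    (he : IsQuotientChart I p e) (he' : IsQuotientChart I p e') :
    e.symm ≫ₕ e' ∈ contDiffGroupoid ∞ 𝓘(𝕜, N) := by
  rw [contDiffGroupoid, mem_groupoid_of_pregroupoid]
  have h1 := he.contDiffOn_coordChange he'
  have h2 := he'.contDiffOn_coordChange he
  constructor
  · simpa [contDiffPregroupoid] using h1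
  · simpa [contDiffPregroupoid] using h2

/-- A quotient map with smooth local sections, whose fibres are locally the fibres of a linear
projection, has a quotient manifold: the atlas consists of all the quotient charts. -/
theorem nonempty_quotientManifold [CompleteSpace N] {F : Type*} [NormedAddCommGroup F]
    [NormedSpace 𝕜 F] (hp : Function.Surjective p)
    (h : ∀ m : M, ∃ e : OpenPartialHomeomorph X N, IsQuotientChart I p e ∧
      ∃ φ ∈ IsManifold.maximalAtlas I ∞ M, ∃ L : E ≃L[𝕜] N × F, m ∈ φ.source ∧
        ∀ z ∈ φ.source, p z ∈ e.source ∧ e (p z) = (L (I (φ z))).1) :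
    Nonempty (QuotientManifold.{w} I p) := by
  have hx : ∀ x : X, ∃ e : OpenPartialHomeomorph X N, IsQuotientChart I p e ∧ x ∈ e.source := by
    intro x
    obtain ⟨m, rfl⟩ := hp x
    obtain ⟨e, he, φ, -, L, hm, hφ⟩ := h m
    exact ⟨e, he, (hφ m hm).1⟩
  choose c hc hxc using hx
  let cs : ChartedSpace N X :=
    { atlas := {e | IsQuotientChart I p e}
      chartAt := c
      mem_chart_source := hxc
      chart_mem_atlas := hc }
  have hgr : HasGroupoid X (contDiffGroupoid ∞ 𝓘(𝕜, N)) :=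
    ⟨fun he he' => he.coordChange_mem_groupoid he'⟩
  have hman : IsManifold 𝓘(𝕜, N) ∞ X := { hgr with }
  refine ⟨{ Model := N, chartedSpace := cs, isManifold := hman, submersion := fun m => ?_ }⟩
  obtain ⟨e, he, φ, hφ, L, hm, hLφ⟩ := h m
  refine (Manifold.IsSubmersionAtOfComplement.mk_of_charts L φ e hm (hLφ m hm).1 hφ
    (IsManifold.subset_maximalAtlas he) (fun z hz => (hLφ z hz).1) ?_).isSubmersionAt
  intro v hv
  have hv' : I.symm v ∈ φ.target ∧ v ∈ range I := by simpa [and_comm] using hv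
  have h1 := (hLφ _ (φ.map_target hv'.1)).2
  rw [φ.right_inv hv'.1, I.right_inv hv'.2] at h1
  simpa using h1

/-- Quotient charts come from maps `q` that are smooth on a saturated open set, constant on the
fibres, and have a smooth section `σ`. -/
theorem exists_isQuotientChart (hp : IsQuotientMap p) {Ω : Set X} (hΩ : IsOpen Ω) {U : Set N}
    (hU : IsOpen U) {q : M → N} {σ : N → M} (hq : ContMDiffOn I 𝓘(𝕜, N) ∞ q (p ⁻¹' Ω))
    (hqp : ∀ z z', p z ∈ Ω → p z = p z' → q z = q z') (hqU : ∀ z, p z ∈ Ω → q z ∈ U)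
    (hσ : ContMDiffOn 𝓘(𝕜, N) I ∞ σ U) (hσΩ : ∀ y ∈ U, p (σ y) ∈ Ω)
    (hqσ : ∀ y ∈ U, q (σ y) = y) (hσq : ∀ z, p z ∈ Ω → p (σ (q z)) = p z) :
    ∃ e : OpenPartialHomeomorph X N, IsQuotientChart I p e ∧ e.source = Ω ∧
      ∀ z, p z ∈ Ω → e (p z) = q z := by
  set c : X → N := fun x => q (Function.surjInv hp.surjective x) with hc
  have hcp : ∀ z, p z ∈ Ω → c (p z) = q z := fun z hz =>
    (hqp z _ hz (Function.surjInv_eq hp.surjective (p z)).symm).symm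
  let e : OpenPartialHomeomorph X N :=
    { toFun := c
      invFun := fun y => p (σ y)
      source := Ω
      target := U
      map_source' := fun x hx => by
        obtain ⟨z, rfl⟩ := hp.surjective x
        rw [hcp z hx]
        exact hqU z hx
      map_target' := fun y hy => hσΩ y hy
      left_inv' := fun x hx => by
        obtain ⟨z, rfl⟩ := hp.surjective x
        rw [hcp z hx]
        exact hσq z hx
      right_inv' := fun y hy => by
        rw [hcp _ (hσΩ y hy)]
        exact hqσ y hy
      open_source := hΩ
      open_target := hU
      continuousOn_toFun := by
        rw [hp.continuousOn_isOpen_iff hΩ]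
        exact hq.continuousOn.congr fun z hz => hcp z hz
      continuousOn_invFun := hp.continuous.comp_continuousOn hσ.continuousOn }
  exact ⟨e, ⟨hq.congr fun z hz => hcp z hz, σ, hσ, fun y _ => rfl⟩, rfl, hcp⟩

end QuotientCharts

/-! ### Maps out of a quotient manifold -/

section Descent

open Set Topology

variable {𝕜 : Type*} [NontriviallyNormedField 𝕜]
  {E E₁ E₂ H H₁ H₂ M X Y : Type*} [NormedAddCommGroup E] [NormedSpace 𝕜 E]
  [NormedAddCommGroup E₁] [NormedSpace 𝕜 E₁] [NormedAddCommGroup E₂] [NormedSpace 𝕜 E₂]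
  [TopologicalSpace H] [TopologicalSpace H₁] [TopologicalSpace H₂] {I : ModelWithCorners 𝕜 E H}
  {I₁ : ModelWithCorners 𝕜 E₁ H₁} {I₂ : ModelWithCorners 𝕜 E₂ H₂}
  [TopologicalSpace M] [ChartedSpace H M] [TopologicalSpace X] [ChartedSpace H₁ X]
  [TopologicalSpace Y] [ChartedSpace H₂ Y]

/-- A map out of the target of a submersion `p` is smooth at `p m` if its composition with `p` is
smooth, because `p` has a smooth local section at `m`. -/
theorem contMDiffAt_of_comp_submersion [I.Boundaryless] {p : M → X} {m : M}
    (hp : Manifold.IsSubmersionAt I I₁ ∞ p m) {f : X → Y} (hf : ContMDiff I I₂ ∞ (f ∘ p)) :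
    ContMDiffAt I₁ I₂ ∞ f (p m) := by
  set φ := hp.domChart
  set ψ := hp.codChart
  set L := hp.equiv
  have hφ := hp.domChart_mem_maximalAtlas
  have hψ := hp.codChart_mem_maximalAtlas
  have hm : m ∈ φ.source := hp.mem_domChart_source
  have hpm : p m ∈ ψ.source := hp.mem_codChart_source
  set v := φ.extend I m with hv
  have hvt : v ∈ (φ.extend I).target := (φ.extend I).map_source (by rwa [φ.extend_source])
  have hw := hp.writtenInCharts
  set s : X → E := fun x => L.symm (ψ.extend I₁ x, (L v).2) with hs
  have hψm : ψ.extend I₁ (p m) = (L v).1 := by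
    have := hw hvt
    simp only [Function.comp_apply] at this
    rw [hv, φ.extend_left_inv hm] at this
    exact this
  have hsm : s (p m) = v := by
    simp only [hs, hψm]
    exact L.symm_apply_apply v
  have hsd : ContMDiffAt I₁ 𝓘(𝕜, E) ∞ s (p m) := by
    have e1 : ContMDiffAt I₁ 𝓘(𝕜, E₁) ∞ (ψ.extend I₁) (p m) :=
      ψ.contMDiffAt_extend hψ hpm
    refine ContMDiffAt.comp (p m) (g := fun y : E₁ => L.symm (y, (L v).2)) ?_ e1
    exact (L.symm.contDiff.comp (contDiff_id.prodMk contDiff_const)).contMDiff.contMDiffAt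
  have ht : (φ.extend I).target ∈ 𝓝 v := φ.isOpen_extend_target.mem_nhds hvt
  have hσ : ContMDiffAt 𝓘(𝕜, E) I ∞ (φ.extend I).symm (s (p m)) := by
    rw [hsm]
    have e2 := contMDiffOn_extend_symm hφ
    rw [← OpenPartialHomeomorph.extend_target'] at e2
    exact e2.contMDiffAt ht
  have hpσ : ∀ᶠ x in 𝓝 (p m), p ((φ.extend I).symm (s x)) = x := by
    have e3 : ∀ᶠ x in 𝓝 (p m), s x ∈ (φ.extend I).target :=
      hsd.continuousAt.eventually (by rwa [hsm])
    filter_upwards [e3, ψ.open_source.mem_nhds hpm] with x hx hxψ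
    have e4 := hw hx
    have e5 : L (s x) = (ψ.extend I₁ x, (L v).2) := L.apply_symm_apply _
    have e6 : ψ.extend I₁ (p ((φ.extend I).symm (s x))) = ψ.extend I₁ x :=
      e4.trans (congrArg Prod.fst e5)
    have e7 : (φ.extend I).symm (s x) ∈ φ.source := by
      simpa using (φ.extend I).map_target hx
    have e8 : p ((φ.extend I).symm (s x)) ∈ ψ.source := hp.source_subset_preimage_source e7
    refine (ψ.extend I₁).injOn ?_ ?_ e6
    · rwa [ψ.extend_source]
    · rwa [ψ.extend_source]
  have h1 : ContMDiffAt I₁ I₂ ∞ (fun x => f (p ((φ.extend I).symm (s x)))) (p m) := by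
    exact ContMDiffAt.comp (p m) (g := f ∘ p) hf.contMDiffAt (hσ.comp (p m) hsd)
  exact h1.congr_of_eventuallyEq (hpσ.mono fun x hx => congrArg f hx.symm)

end Descent

/-! ### Slice charts of a Banach–Lie subgroup -/

section InverseFunction

open Set Topology

/-- The inverse function theorem, with smoothness of the inverse on a whole neighbourhood. -/
theorem exists_openPartialHomeomorph_of_contDiffOn {𝕜 : Type*} [RCLike 𝕜] {E : Type*}
    [NormedAddCommGroup E] [NormedSpace 𝕜 E] [CompleteSpace E] {f : E → E} {U : Set E} {x : E}
    (hU : IsOpen U) (hx : x ∈ U) (hf : ContDiffOn 𝕜 ∞ f U) {f' : E ≃L[𝕜] E}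
    (hf' : HasFDerivAt f (f' : E →L[𝕜] E) x) :
    ∃ e : OpenPartialHomeomorph E E, (e : E → E) = f ∧ x ∈ e.source ∧ e.source ⊆ U ∧
      ContDiffOn 𝕜 ∞ e.symm e.target := by
  have hfx : ContDiffAt 𝕜 ∞ f x := hf.contDiffAt (hU.mem_nhds hx)
  set e₀ := hfx.toOpenPartialHomeomorph f hf' (by simp)
  set V := U ∩ fderiv 𝕜 f ⁻¹' range ((↑) : (E ≃L[𝕜] E) → (E →L[𝕜] E)) with hV
  have hVo : IsOpen V := (hf.continuousOn_fderiv_of_isOpen hU (by simp)).isOpen_inter_preimage hU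
    ContinuousLinearEquiv.isOpen
  have hxV : x ∈ V := ⟨hx, f', hf'.fderiv.symm⟩
  refine ⟨e₀.restrOpen V hVo, rfl, ⟨hfx.mem_toOpenPartialHomeomorph_source hf' _, hxV⟩,
    fun y hy => hy.2.1, fun y hy => ?_⟩
  have hy' := (e₀.restrOpen V hVo).map_target hy
  obtain ⟨hU', g, hg⟩ := hy'.2
  have hd : ContDiffAt 𝕜 ∞ f ((e₀.restrOpen V hVo).symm y) := hf.contDiffAt (hU.mem_nhds hU')
  refine ((e₀.restrOpen V hVo).contDiffAt_symm hy (f₀' := g) ?_ hd).contDiffWithinAt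
  rw [hg]
  exact (hd.differentiableAt (by simp)).hasFDerivAt

end InverseFunction

section SliceChart

open Set Topology Filter

variable {𝕜 : Type*} [RCLike 𝕜] {E : Type*} [NormedAddCommGroup E] [NormedSpace 𝕜 E]
  {G : Type*} [Group G] [TopologicalSpace G] [ChartedSpace E G]

/-- A slice chart `κ` for a subgroup `B`: the first coordinate of `L ∘ κ` is a coordinate on the
set of cosets of `B`, and the target of `L ∘ κ` contains with `(y, y')` also `(y, 0)`. -/
structure IsSliceChart (B : Subgroup G) {N F : Type*} [NormedAddCommGroup N] [NormedSpace 𝕜 N]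
    [NormedAddCommGroup F] [NormedSpace 𝕜 F] (L : E ≃L[𝕜] N × F)
    (κ : OpenPartialHomeomorph G E) : Prop where
  mem_maximalAtlas : κ ∈ IsManifold.maximalAtlas 𝓘(𝕜, E) ∞ G
  map_target : ∀ v ∈ κ.target, L.symm ((L v).1, 0) ∈ κ.target
  inv_mul_mem_iff : ∀ x ∈ κ.source, ∀ y ∈ κ.source, x⁻¹ * y ∈ B ↔ (L (κ x)).1 = (L (κ y)).1

variable [LieGroup 𝓘(𝕜, E) ∞ G]

/-- A slice chart at the unit element exists. If `φ` is a chart in which `B` is the complemented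
subspace `F` with projection `P`, and `s` is the inverse of `φ` translated so that `s 0 = 1`, then
`v ↦ s (v - P v) * s (P v)` has an invertible derivative at `0`, and its local inverse is a slice
chart. -/
theorem exists_isSliceChart_one [CompleteSpace E] {B : Subgroup G}
    (hB : IsBanachLieSubgroup 𝕜 E B) :
    ∃ (N F : Submodule 𝕜 E) (_ : CompleteSpace N) (L : E ≃L[𝕜] N × F)
      (κ : OpenPartialHomeomorph G E), 1 ∈ κ.source ∧ IsSliceChart B L κ := by
  have := topologicalGroup_of_lieGroup 𝓘(𝕜, E) ∞ (G := G)
  have : IsManifold 𝓘(𝕜, E) ∞ G := ContMDiffMul.toIsManifold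
  obtain ⟨φ, hφ, F, ⟨P, hP⟩, h1, hBφ⟩ := hB 1 B.one_mem
  set N : Submodule 𝕜 E := LinearMap.ker (P : E →ₗ[𝕜] F) with hN
  have hNc : IsClosed (N : Set E) := P.isClosed_ker
  let L : E ≃L[𝕜] N × F :=
    (ContinuousLinearEquiv.equivOfRightInverse P F.subtypeL fun f => hP f).trans
      (ContinuousLinearEquiv.prodComm 𝕜 F N)
  set p : E →L[𝕜] E := F.subtypeL.comp P with hp
  set q : E →L[𝕜] E := ContinuousLinearMap.id 𝕜 E - p with hq
  have hpF : ∀ v, p v ∈ F := fun v => (P v).2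
  have hpf : ∀ v ∈ F, p v = v := fun v hv => congrArg Subtype.val (hP ⟨v, hv⟩)
  have hqv : ∀ v, q v = v - p v := fun v => rfl
  have hpp : ∀ v, p (p v) = p v := fun v => hpf _ (hpF v)
  have hpq : ∀ v, p (q v) = 0 := fun v => by rw [hqv, map_sub, hpp, sub_self]
  have hqq : ∀ v, q (q v) = q v := fun v => by rw [hqv (q v), hpq, sub_zero]
  have hqf : ∀ v ∈ F, q v = 0 := fun v hv => by rw [hqv, hpf v hv, sub_self]
  have hqp : ∀ v, q v + p v = v := fun v => sub_add_cancel _ _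
  have hL1 : ∀ v, (((L v).1 : N) : E) = q v := fun v => rfl
  have hLs : ∀ v, L.symm ((L v).1, 0) = q v := by
    intro v
    rw [ContinuousLinearEquiv.symm_apply_eq]
    refine Prod.ext (Subtype.ext ?_) (Subtype.ext ?_)
    · rw [hL1, hL1, hqq]
    · exact (hpq v).symm
  set a := φ 1
  have haF : a ∈ F := (hBφ 1 h1).1 B.one_mem
  have ha : a ∈ φ.target := φ.map_source h1
  set s : E → G := fun v => φ.symm (a + v) with hs
  have hs0 : s 0 = 1 := by simp [hs, a, φ.left_inv h1]
  have hsB : ∀ v ∈ F, a + v ∈ φ.target → s v ∈ B := fun v hv hv' => by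
    rw [hBφ _ (φ.map_target hv'), φ.right_inv hv']
    exact F.add_mem haF hv
  have hss : ∀ u : E →L[𝕜] E, ContMDiffOn 𝓘(𝕜, E) 𝓘(𝕜, E) ∞ (fun v => s (u v))
      {v | a + u v ∈ φ.target} := fun u =>
    (contMDiffOn_symm_of_mem_maximalAtlas hφ).comp
      (contDiff_const.add u.contDiff).contMDiff.contMDiffOn fun v hv => hv
  have hto : ∀ u : E →L[𝕜] E, IsOpen {v | a + u v ∈ φ.target} := fun u =>
    φ.open_target.preimage (by fun_prop)
  -- the map `w v = s (q v) * s (p v)`, its domain `U`, and its expression `Ψ` in the chart `φ`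
  set w : E → G := fun v => s (q v) * s (p v) with hw
  set U₀ := {v | a + q v ∈ φ.target} ∩ {v | a + p v ∈ φ.target}
  have hU₀ : IsOpen U₀ := (hto q).inter (hto p)
  have hw₀ : ContMDiffOn 𝓘(𝕜, E) 𝓘(𝕜, E) ∞ w U₀ :=
    ((hss q).mono inter_subset_left).mul ((hss p).mono inter_subset_right)
  set U := U₀ ∩ w ⁻¹' φ.source with hUdef
  have hU : IsOpen U := hw₀.continuousOn.isOpen_inter_preimage hU₀ φ.open_source
  have h0U : (0 : E) ∈ U := by
    refine ⟨⟨?_, ?_⟩, ?_⟩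
    · simpa using ha
    · simpa using ha
    · simpa [hw, hs0] using h1
  set Ψ : E → E := fun v => φ (w v) with hΨ
  have hΨc : ContDiffOn 𝕜 ∞ Ψ U := contMDiffOn_iff_contDiffOn.1
    ((contMDiffOn_of_mem_maximalAtlas hφ).comp (hw₀.mono inter_subset_left) fun v hv => hv.2)
  have hφs : ∀ᶠ x in 𝓝 (0 : E), φ (s x) = a + x := by
    have e1 : ContinuousAt (fun x => a + x) 0 := by fun_prop
    filter_upwards [e1.eventually (φ.open_target.mem_nhds (by simpa using ha))] with x hx
    exact φ.right_inv hx
  have hs0c : ContMDiffAt 𝓘(𝕜, E) 𝓘(𝕜, E) ∞ s 0 :=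
    (hss (ContinuousLinearMap.id 𝕜 E)).contMDiffAt ((hto _).mem_nhds (by simpa using ha))
  have hΨ' : HasFDerivAt Ψ (ContinuousLinearMap.id 𝕜 E) 0 := by
    set m : E × E → E := fun z => φ (s z.1 * s z.2) with hm
    have e1 : ContMDiffAt 𝓘(𝕜, E × E) 𝓘(𝕜, E) ∞ (fun z : E × E => s z.1) 0 :=
      ContMDiffAt.comp (0 : E × E) (g := s) hs0c contDiff_fst.contMDiff.contMDiffAt
    have e2 : ContMDiffAt 𝓘(𝕜, E × E) 𝓘(𝕜, E) ∞ (fun z : E × E => s z.2) 0 :=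
      ContMDiffAt.comp (0 : E × E) (g := s) hs0c contDiff_snd.contMDiff.contMDiffAt
    have e3 : ContMDiffAt 𝓘(𝕜, E × E) 𝓘(𝕜, E) ∞ m 0 := by
      refine ContMDiffAt.comp (0 : E × E) (g := φ) ?_ (e1.mul e2)
      refine contMDiffAt_of_mem_maximalAtlas hφ ?_
      simpa [hs0] using h1
    have hmd : HasFDerivAt m (fderiv 𝕜 m 0) 0 :=
      ((contMDiffAt_iff_contDiffAt.1 e3).differentiableAt (by simp)).hasFDerivAt
    have e4 : (fderiv 𝕜 m 0).comp (ContinuousLinearMap.inl 𝕜 E E) = ContinuousLinearMap.id 𝕜 E := by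
      have f1 : HasFDerivAt (fun x => m (x, 0)) _ 0 :=
        HasFDerivAt.comp (0 : E) (g := m) hmd (hasFDerivAt_prodMk_left (0 : E) (0 : E))
      refine f1.unique (((hasFDerivAt_id (0 : E)).const_add a).congr_of_eventuallyEq ?_)
      filter_upwards [hφs] with x hx
      simp [hm, hs0, hx]
    have e5 : (fderiv 𝕜 m 0).comp (ContinuousLinearMap.inr 𝕜 E E) = ContinuousLinearMap.id 𝕜 E := by
      have f1 : HasFDerivAt (fun x => m (0, x)) _ 0 :=
        HasFDerivAt.comp (0 : E) (g := m) hmd (hasFDerivAt_prodMk_right (0 : E) (0 : E))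
      refine f1.unique (((hasFDerivAt_id (0 : E)).const_add a).congr_of_eventuallyEq ?_)
      filter_upwards [hφs] with x hx
      simp [hm, hs0, hx]
    have e6 : HasFDerivAt Ψ ((fderiv 𝕜 m 0).comp (q.prod p)) 0 := by
      refine HasFDerivAt.comp (0 : E) (g := m) (f := fun v => (q v, p v)) ?_
        (q.prod p).hasFDerivAt
      have e7 : ((q 0, p 0) : E × E) = 0 := by simp
      change HasFDerivAt m _ (q 0, p 0)
      rwa [e7]
    convert! e6 using 1
    ext v
    have f1 := DFunLike.congr_fun e4 (q v)
    have f2 := DFunLike.congr_fun e5 (p v)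
    simp only [ContinuousLinearMap.comp_apply, ContinuousLinearMap.inl_apply,
      ContinuousLinearMap.inr_apply, ContinuousLinearMap.id_apply] at f1 f2
    have f3 : ((q v, p v) : E × E) = (q v, 0) + (0, p v) := by simp
    simp only [ContinuousLinearMap.comp_apply, ContinuousLinearMap.prod_apply,
      ContinuousLinearMap.id_apply]
    rw [f3, map_add, f1, f2, hqp]
  obtain ⟨e, heΨ, he0, heU, hesymm⟩ := exists_openPartialHomeomorph_of_contDiffOn hU h0U hΨc
    (f' := ContinuousLinearEquiv.refl 𝕜 E) hΨ'
  -- a box `‖q v‖, ‖p v‖ < ε₀` in the domain of the local inverse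
  obtain ⟨ε₀, hε₀, hbox⟩ : ∃ ε₀ > 0, ∀ v, ‖q v‖ < ε₀ → ‖p v‖ < ε₀ → v ∈ e.source := by
    obtain ⟨ε, hε, h⟩ := Metric.isOpen_iff.1 e.open_source 0 he0
    refine ⟨ε / 2, by positivity, fun v h2 h3 => h ?_⟩
    rw [mem_ball_zero_iff, ← hqp v]
    exact (norm_add_le _ _).trans_lt (by linarith)
  -- a smaller box, in which the quotients `s (q v)⁻¹ * s (q v')` stay in the domain of `φ`
  have hquot : ∀ᶠ z in 𝓝 (0 : E × E), (s z.1)⁻¹ * s z.2 ∈ φ.source ∧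
      ‖p (φ ((s z.1)⁻¹ * s z.2) - a)‖ < ε₀ := by
    have c1 : ContinuousAt (fun z : E × E => (s z.1)⁻¹ * s z.2) 0 := by
      have f1 : ContinuousAt (fun z : E × E => s z.1) 0 :=
        ContinuousAt.comp (g := s) hs0c.continuousAt continuousAt_fst
      have f2 : ContinuousAt (fun z : E × E => s z.2) 0 :=
        ContinuousAt.comp (g := s) hs0c.continuousAt continuousAt_snd
      exact f1.inv.mul f2
    have c0 : (s (0 : E × E).1)⁻¹ * s (0 : E × E).2 = 1 := by simp [hs0]
    have c2 : ContinuousAt (fun z : E × E => ‖p (φ ((s z.1)⁻¹ * s z.2) - a)‖) 0 := by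
      have f1 : ContinuousAt (fun z : E × E => φ ((s z.1)⁻¹ * s z.2)) 0 :=
        ContinuousAt.comp (g := φ) (by rw [c0]; exact φ.continuousAt h1) c1
      exact (p.continuous.continuousAt.comp (f1.sub continuousAt_const)).norm
    refine (c1.eventually (φ.open_source.mem_nhds (by beta_reduce; rwa [c0]))).and
      (c2.eventually_lt_const ?_)
    beta_reduce
    rw [c0]
    simpa [a] using hε₀
  obtain ⟨ε₁, hε₁, hquot⟩ := Metric.eventually_nhds_iff.1 hquot
  set ε := min ε₀ ε₁
  have hε : 0 < ε := lt_min hε₀ hε₁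
  set V := {v : E | ‖q v‖ < ε ∧ ‖p v‖ < ε} with hVdef
  have hV : IsOpen V := by
    exact (isOpen_lt q.continuous.norm continuous_const).inter
      (isOpen_lt p.continuous.norm continuous_const)
  have hVe : V ⊆ e.source := fun v hv =>
    hbox v (hv.1.trans_le (min_le_left _ _)) (hv.2.trans_le (min_le_left _ _))
  set χ := e.restrOpen V hV ≫ₕ φ.symm with hχ
  have hχV : χ.source = V := by
    refine Subset.antisymm (fun v hv => hv.1.2) fun v hv => ⟨⟨hVe hv, hv⟩, ?_⟩
    change e v ∈ φ.target
    rw [heΨ]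
    exact φ.map_source (heU (hVe hv)).2
  have hχw : ∀ v ∈ V, χ v = w v := fun v hv => by
    change φ.symm (e v) = w v
    rw [heΨ]
    exact φ.left_inv (heU (hVe hv)).2
  have h0V : (0 : E) ∈ V := by simp [hVdef, hε]
  refine ⟨N, F, hNc.completeSpace_coe, L, χ.symm, ?_, ?_, ?_, ?_⟩
  · have := χ.map_source (hχV.symm ▸ h0V)
    rw [hχw 0 h0V] at this
    simpa [hw, hs0] using this
  · refine OpenPartialHomeomorph.mem_maximalAtlas_of_contMDiffOn _ ?_ ?_
    · have : χ.symm.source ⊆ φ.source ∩ φ ⁻¹' e.target := by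
        intro x hx
        have hx' := χ.map_target hx
        have hx2 : x = χ (χ.symm x) := (χ.right_inv hx).symm
        rw [hχV] at hx'
        have hv := hVe hx'
        rw [hx2, hχw _ hx']
        refine ⟨(heU hv).2, ?_⟩
        have := e.map_source hv
        rwa [heΨ] at this
      refine ((contMDiffOn_iff_contDiffOn.2 hesymm).comp
        ((contMDiffOn_of_mem_maximalAtlas hφ).mono (this.trans inter_subset_left))
        fun x hx => (this hx).2)
    · refine (hw₀.mono fun v hv => ?_).congr fun v hv => ?_
      · exact (heU (hVe (hχV ▸ hv))).1
      · exact hχw v (hχV ▸ hv)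
  · intro v hv
    have hv' : v ∈ V := hχV ▸ hv
    change L.symm ((L v).1, 0) ∈ χ.source
    rw [hLs, hχV]
    refine ⟨by rw [hqq]; exact hv'.1, by rw [hpq, norm_zero]; exact hε⟩
  · intro x hx y hy
    have hv : χ.symm x ∈ V := hχV ▸ χ.map_target hx
    have hu : χ.symm y ∈ V := hχV ▸ χ.map_target hy
    have hxw : x = w (χ.symm x) := by rw [← hχw _ hv]; exact (χ.right_inv hx).symm
    have hyw : y = w (χ.symm y) := by rw [← hχw _ hu]; exact (χ.right_inv hy).symm
    generalize χ.symm x = v at *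
    generalize χ.symm y = u at *
    have hvU := (heU (hVe hv)).1
    have huU := (heU (hVe hu)).1
    set b := (s (q v))⁻¹ * s (q u) with hb
    have hbq : ‖(q v, q u)‖ < ε₁ := by
      rw [Prod.norm_def]
      exact (max_lt hv.1 hu.1).trans_le (min_le_right _ _)
    obtain ⟨hbφ, hbp⟩ := hquot (y := (q v, q u)) (by simpa using hbq)
    change b ∈ φ.source at hbφ
    change ‖p (φ b - a)‖ < ε₀ at hbp
    have h2 : x⁻¹ * y ∈ B ↔ b ∈ B := by
      have : x⁻¹ * y = (s (p v))⁻¹ * b * s (p u) := by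
        rw [hxw, hyw, hb, hw]; simp only [mul_inv_rev, mul_assoc]
      rw [this, B.mul_mem_cancel_right (hsB _ (hpF u) huU.2),
        B.mul_mem_cancel_left (B.inv_mem (hsB _ (hpF v) hvU.2))]
    rw [h2, ← Subtype.coe_inj, hL1, hL1]
    refine ⟨fun hbB => ?_, fun h => ?_⟩
    · have hyF : φ b - a ∈ F := F.sub_mem ((hBφ b hbφ).1 hbB) haF
      have hsb : s (φ b - a) = b := by simp [hs, φ.left_inv hbφ]
      have q1 : q (q v + (φ b - a)) = q v := by rw [map_add, hqq, hqf _ hyF, add_zero]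
      have p1 : p (q v + (φ b - a)) = φ b - a := by rw [map_add, hpq, hpf _ hyF, zero_add]
      have m1 : q v + (φ b - a) ∈ e.source := by
        refine hbox _ ?_ ?_
        · rw [q1]; exact hv.1.trans_le (min_le_left _ _)
        · rw [p1, ← hpf _ hyF]; exact hbp
      have m2 : q u ∈ e.source := by
        refine hbox _ ?_ ?_
        · rw [hqq]; exact hu.1.trans_le (min_le_left _ _)
        · rw [hpq, norm_zero]; exact hε₀
      have h3 : e (q v + (φ b - a)) = e (q u) := by
        rw [heΨ]
        simp only [hΨ, hw]
        rw [q1, p1, hsb, hqq, hpq, hs0, mul_one, hb, mul_inv_cancel_left]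
      have h4 := congrArg q (e.injOn m1 m2 h3)
      rwa [q1, hqq] at h4
    · have : b = 1 := by rw [hb, h, inv_mul_cancel]
      rw [this]
      exact B.one_mem

/-- Left translates of slice charts are slice charts. -/
theorem IsSliceChart.translate {B : Subgroup G} {N F : Type*} [NormedAddCommGroup N]
    [NormedSpace 𝕜 N] [NormedAddCommGroup F] [NormedSpace 𝕜 F] {L : E ≃L[𝕜] N × F}
    {κ : OpenPartialHomeomorph G E} (hκ : IsSliceChart B L κ) (h1 : 1 ∈ κ.source) (g : G) :
    ∃ κ' : OpenPartialHomeomorph G E, g ∈ κ'.source ∧ IsSliceChart B L κ' := by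
  have := topologicalGroup_of_lieGroup 𝓘(𝕜, E) ∞ (G := G)
  have : IsManifold 𝓘(𝕜, E) ∞ G := ContMDiffMul.toIsManifold
  have hs : ∀ x, x ∈ ((Homeomorph.mulLeft g⁻¹).toOpenPartialHomeomorph ≫ₕ κ).source ↔
      g⁻¹ * x ∈ κ.source := by simp
  have ht : ((Homeomorph.mulLeft g⁻¹).toOpenPartialHomeomorph ≫ₕ κ).target = κ.target := by simp
  refine ⟨(Homeomorph.mulLeft g⁻¹).toOpenPartialHomeomorph ≫ₕ κ, by simpa using h1, ?_, ?_, ?_⟩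
  · refine OpenPartialHomeomorph.mem_maximalAtlas_of_contMDiffOn _ ?_ ?_
    · exact (contMDiffOn_of_mem_maximalAtlas hκ.mem_maximalAtlas).comp
        (contMDiff_mul_left (a := g⁻¹)).contMDiffOn fun x hx => (hs x).1 hx
    · rw [ht]
      have h2 := (contMDiff_mul_left (I := 𝓘(𝕜, E)) (n := ∞) (a := g)).comp_contMDiffOn
        (contMDiffOn_symm_of_mem_maximalAtlas hκ.mem_maximalAtlas)
      refine h2.congr fun x hx => ?_
      change g⁻¹⁻¹ * κ.symm x = g * κ.symm x
      rw [inv_inv]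
  · intro v hv
    rw [ht] at hv ⊢
    exact hκ.map_target v hv
  · intro x hx y hy
    have := hκ.inv_mul_mem_iff _ ((hs x).1 hx) _ ((hs y).1 hy)
    simpa [mul_assoc] using this

end SliceChart

/-! ### Coordinates on the set of cosets -/

noncomputable section

section SliceCoord

open Set Topology Filter

variable {𝕜 : Type*} [RCLike 𝕜] {E : Type*} [NormedAddCommGroup E] [NormedSpace 𝕜 E]
  {G : Type*} [TopologicalSpace G] {N F : Type*} [NormedAddCommGroup N] [NormedSpace 𝕜 N]
  [NormedAddCommGroup F] [NormedSpace 𝕜 F]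

section

variable (L : E ≃L[𝕜] N × F) (κ : OpenPartialHomeomorph G E)

/-- The section of the coset coordinate `sliceCoord` given by the slice chart `κ`. -/
def sliceSection (y : N) : G := κ.symm (L.symm (y, 0))

/-- The range of the coset coordinate `sliceCoord`, the domain of `sliceSection`. -/
def sliceRange : Set N := {y | L.symm (y, 0) ∈ κ.target}

theorem isOpen_sliceRange : IsOpen (sliceRange L κ) :=
  κ.open_target.preimage (L.symm.continuous.comp (by fun_prop))

variable {L κ} in
theorem sliceSection_mem_source {y : N} (hy : y ∈ sliceRange L κ) : sliceSection L κ y ∈ κ.source :=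
  κ.map_target hy

end

variable [Group G]

section

variable (B : Subgroup G) (L : E ≃L[𝕜] N × F) (κ : OpenPartialHomeomorph G E)

/-- The union of the cosets of `B` that meet the domain of the slice chart `κ`. -/
def sliceDomain : Set G := {z | ∃ x ∈ κ.source, z⁻¹ * x ∈ B}

open scoped Classical in
/-- The coordinate on the set of cosets of `B` given by the slice chart `κ`, as a function on `G`.
It has the value `0` outside `sliceDomain B κ`. -/
def sliceCoord (z : G) : N := if h : ∃ x ∈ κ.source, z⁻¹ * x ∈ B then (L (κ h.choose)).1 else 0

theorem isOpen_sliceDomain [IsTopologicalGroup G] : IsOpen (sliceDomain B κ) := by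
  have h : sliceDomain B κ = ⋃ b ∈ B, (fun z => z * b) ⁻¹' κ.source := by
    ext z
    simp only [sliceDomain, mem_ofPred_eq, mem_iUnion, mem_preimage, exists_prop]
    constructor
    · rintro ⟨x, hx, hzx⟩
      exact ⟨z⁻¹ * x, hzx, by simpa using hx⟩
    · rintro ⟨b, hb, hzb⟩
      exact ⟨z * b, hzb, by simpa using hb⟩
  rw [h]
  exact isOpen_biUnion fun b _ => κ.open_source.preimage (by fun_prop)

end

variable {B : Subgroup G} {L : E ≃L[𝕜] N × F} {κ : OpenPartialHomeomorph G E}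

theorem subset_sliceDomain : κ.source ⊆ sliceDomain B κ := fun x hx =>
  ⟨x, hx, by simp⟩

theorem mul_mem_sliceDomain {z w : G} (hz : z ∈ sliceDomain B κ) (hw : w ∈ B) :
    z * w ∈ sliceDomain B κ := by
  obtain ⟨x, hx, hzx⟩ := hz
  exact ⟨x, hx, by rw [mul_inv_rev, mul_assoc]; exact B.mul_mem (B.inv_mem hw) hzx⟩

variable [ChartedSpace E G]

namespace IsSliceChart

theorem sliceCoord_eq (hκ : IsSliceChart B L κ) {z x : G} (hx : x ∈ κ.source) (hzx : z⁻¹ * x ∈ B) :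
    sliceCoord B L κ z = (L (κ x)).1 := by
  have h : ∃ x ∈ κ.source, z⁻¹ * x ∈ B := ⟨x, hx, hzx⟩
  rw [sliceCoord, dif_pos h]
  refine (hκ.inv_mul_mem_iff _ h.choose_spec.1 _ hx).1 ?_
  have := B.mul_mem (B.inv_mem h.choose_spec.2) hzx
  simpa using this

theorem sliceCoord_of_mem (hκ : IsSliceChart B L κ) {z : G} (hz : z ∈ κ.source) :
    sliceCoord B L κ z = (L (κ z)).1 :=
  hκ.sliceCoord_eq hz (by simp)

theorem sliceCoord_mul (hκ : IsSliceChart B L κ) {z w : G} (hz : z ∈ sliceDomain B κ) (hw : w ∈ B) :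
    sliceCoord B L κ (z * w) = sliceCoord B L κ z := by
  obtain ⟨x, hx, hzx⟩ := hz
  rw [hκ.sliceCoord_eq hx hzx, hκ.sliceCoord_eq hx]
  rw [mul_inv_rev, mul_assoc]
  exact B.mul_mem (B.inv_mem hw) hzx

theorem sliceCoord_mem_sliceRange (hκ : IsSliceChart B L κ) {z : G} (hz : z ∈ sliceDomain B κ) :
    sliceCoord B L κ z ∈ sliceRange L κ := by
  obtain ⟨x, hx, hzx⟩ := hz
  rw [hκ.sliceCoord_eq hx hzx]
  exact hκ.map_target _ (κ.map_source hx)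

theorem sliceCoord_sliceSection (hκ : IsSliceChart B L κ) {y : N} (hy : y ∈ sliceRange L κ) :
    sliceCoord B L κ (sliceSection L κ y) = y := by
  rw [hκ.sliceCoord_of_mem (sliceSection_mem_source hy), sliceSection, κ.right_inv hy]
  simp

theorem inv_mul_sliceSection_mem (hκ : IsSliceChart B L κ) {z : G} (hz : z ∈ sliceDomain B κ) :
    z⁻¹ * sliceSection L κ (sliceCoord B L κ z) ∈ B := by
  have hy := hκ.sliceCoord_mem_sliceRange hz
  obtain ⟨x, hx, hzx⟩ := hz
  have h1 : x⁻¹ * sliceSection L κ (sliceCoord B L κ z) ∈ B := by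
    rw [hκ.inv_mul_mem_iff _ hx _ (sliceSection_mem_source hy), sliceSection, κ.right_inv hy,
      hκ.sliceCoord_eq hx hzx]
    simp
  have := B.mul_mem hzx h1
  simpa [mul_assoc] using this

theorem contMDiffOn_sliceSection (hκ : IsSliceChart B L κ) :
    ContMDiffOn 𝓘(𝕜, N) 𝓘(𝕜, E) ∞ (sliceSection L κ) (sliceRange L κ) :=
  (contMDiffOn_symm_of_mem_maximalAtlas hκ.mem_maximalAtlas).comp
    (L.symm.contDiff.comp (contDiff_id.prodMk contDiff_const)).contMDiff.contMDiffOn fun _ hy => hy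

theorem contMDiffOn_sliceCoord [LieGroup 𝓘(𝕜, E) ∞ G] (hκ : IsSliceChart B L κ) :
    ContMDiffOn 𝓘(𝕜, E) 𝓘(𝕜, N) ∞ (sliceCoord B L κ) (sliceDomain B κ) := by
  have := topologicalGroup_of_lieGroup 𝓘(𝕜, E) ∞ (G := G)
  rintro z ⟨x, hx, hzx⟩
  -- near `z`, the coordinate is `L ∘ κ` after the right translation by `z⁻¹ * x`
  have h1 : ContMDiffAt 𝓘(𝕜, E) 𝓘(𝕜, N) ∞ (fun z' => (L (κ (z' * (z⁻¹ * x)))).1) z := by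
    refine ContMDiffAt.comp z (g := fun v => (L v).1)
      (contDiff_fst.comp L.contDiff).contMDiff.contMDiffAt ?_
    refine ContMDiffAt.comp z (g := κ) ?_ contMDiffAt_mul_right
    rw [mul_inv_cancel_left]
    exact contMDiffAt_of_mem_maximalAtlas hκ.mem_maximalAtlas hx
  refine (h1.congr_of_eventuallyEq ?_).contMDiffWithinAt
  have hc : ContinuousAt (fun z' => z' * (z⁻¹ * x)) z := by fun_prop
  filter_upwards [hc.eventually (κ.open_source.mem_nhds (by simpa using hx))] with z' hz'
  exact hκ.sliceCoord_eq hz' (by simpa using hzx)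

end IsSliceChart

end SliceCoord

/-! ### The quotient manifolds `G_A / G_B` and `D` -/

namespace RepresentationPair

open Set Topology Filter

section Algebraic

variable {G H : Type*} [Group G] [StarMul G] [NormedAddCommGroup H]
  [InnerProductSpace ℂ H] [CompleteSpace H] (d : RepresentationPair G H)

theorem toBase_eq_toBase_iff {u v : G} : d.toBase u = d.toBase v ↔ u⁻¹ * v ∈ d.B :=
  QuotientGroup.eq

theorem toTotal_eq_toTotal_iff {x y : G × d.HB} :
    d.toTotal x = d.toTotal y ↔ ∃ w ∈ d.B, y.1 = x.1 * w ∧ (y.2 : H) = d.π w⁻¹ x.2 :=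
  Quotient.eq (r := d.setoid)

theorem P_of_mem {h : H} (hh : h ∈ d.HB) : ((d.P h : d.HB) : H) = h :=
  Submodule.starProjection_eq_self_iff.2 hh

theorem isQuotientMap_toBase [TopologicalSpace G] : IsQuotientMap d.toBase :=
  isQuotientMap_quotient_mk'

theorem isQuotientMap_toTotal [TopologicalSpace G] : IsQuotientMap d.toTotal :=
  isQuotientMap_quotient_mk'

end Algebraic

universe uE uH uk uG

variable {𝕜 : Type uk} [RCLike 𝕜]
  {G : Type uG} [Group G] [StarMul G]
  {H : Type uH} [NormedAddCommGroup H] [InnerProductSpace ℂ H] [CompleteSpace H]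
  (d : RepresentationPair G H)

section BoundedOperators

variable [NormedAlgebra 𝕜 ℂ] [NormedSpace 𝕜 H] [IsScalarTower 𝕜 ℂ H]

theorem isBoundedBilinearMap_P_apply :
    IsBoundedBilinearMap 𝕜 fun p : (H →L[ℂ] H) × H => d.P (p.1 p.2) where
  add_left T T' h := by simp
  smul_left c T h := by
    rw [smul_apply]
    exact d.P.map_smul_of_tower c (T h)
  add_right T h h' := by simp
  smul_right c T h := by
    dsimp only
    rw [T.map_smul_of_tower c h]
    exact d.P.map_smul_of_tower c (T h)
  bound := by
    refine ⟨‖d.P‖ + 1, by positivity, fun T h => ?_⟩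
    calc ‖d.P (T h)‖ ≤ ‖d.P‖ * (‖T‖ * ‖h‖) := d.P.le_opNorm_of_le (T.le_opNorm h)
      _ ≤ (‖d.P‖ + 1) * ‖T‖ * ‖h‖ := by
        rw [mul_assoc]
        exact mul_le_mul_of_nonneg_right (by linarith) (by positivity)

theorem contMDiff_coe_HB : ContMDiff 𝓘(𝕜, d.HB) 𝓘(𝕜, H) ∞ fun f : d.HB => (f : H) :=
  (d.HB.subtypeL.restrictScalars 𝕜).contDiff.contMDiff

end BoundedOperators

variable {E : Type uE} [NormedAddCommGroup E] [NormedSpace 𝕜 E] [TopologicalSpace G]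
  [ChartedSpace E G]

theorem nonempty_baseManifold [CompleteSpace E] [LieGroup 𝓘(𝕜, E) ∞ G]
    (hB : IsBanachLieSubgroup 𝕜 E d.B) : Nonempty (d.BaseManifold 𝕜 E) := by
  have := topologicalGroup_of_lieGroup 𝓘(𝕜, E) ∞ (G := G)
  obtain ⟨N, F, _, L, κ₁, h1, hκ₁⟩ := exists_isSliceChart_one hB
  refine nonempty_quotientManifold (N := N) (F := F) d.isQuotientMap_toBase.surjective fun g => ?_
  obtain ⟨κ, hg, hκ⟩ := hκ₁.translate h1 g
  have hΩ : d.toBase ⁻¹' (d.toBase '' κ.source) = sliceDomain d.B κ := by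
    ext z
    simp only [mem_preimage, mem_image, sliceDomain, mem_ofPred_eq]
    refine exists_congr fun x => and_congr_right fun _ => ?_
    rw [eq_comm, toBase_eq_toBase_iff]
  have hmem : ∀ z, d.toBase z ∈ d.toBase '' κ.source ↔ z ∈ sliceDomain d.B κ := fun z => by
    rw [← hΩ, mem_preimage]
  obtain ⟨e, he, hes, hez⟩ := exists_isQuotientChart (I := 𝓘(𝕜, E)) (N := N)
    d.isQuotientMap_toBase (Ω := d.toBase '' κ.source)
    (d.isQuotientMap_toBase.isOpen_preimage.1
      (hΩ ▸ isOpen_sliceDomain d.B κ))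
    (isOpen_sliceRange L κ) (q := sliceCoord d.B L κ) (σ := sliceSection L κ)
    (hΩ ▸ hκ.contMDiffOn_sliceCoord)
    (fun z z' hz hzz' => by
      have := hκ.sliceCoord_mul ((hmem z).1 hz) (d.toBase_eq_toBase_iff.1 hzz')
      rw [← this, mul_inv_cancel_left])
    (fun z hz => hκ.sliceCoord_mem_sliceRange ((hmem z).1 hz))
    hκ.contMDiffOn_sliceSection
    (fun y hy => mem_image_of_mem _ (sliceSection_mem_source hy))
    (fun y hy => hκ.sliceCoord_sliceSection hy)
    (fun z hz => Eq.symm <|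
      d.toBase_eq_toBase_iff.2 (hκ.inv_mul_sliceSection_mem ((hmem z).1 hz)))
  refine ⟨e, he, κ, hκ.mem_maximalAtlas, L, hg, fun z hz => ?_⟩
  have hz' : d.toBase z ∈ d.toBase '' κ.source := mem_image_of_mem _ hz
  exact ⟨hes ▸ hz', by rw [hez z hz', hκ.sliceCoord_of_mem hz]; rfl⟩

variable [NormedAlgebra 𝕜 ℂ] [NormedSpace 𝕜 H] [IsScalarTower 𝕜 ℂ H]

variable {d}

theorem contMDiffOn_P_π_apply {E' H' M : Type*} [NormedAddCommGroup E'] [NormedSpace 𝕜 E']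
    [TopologicalSpace H'] {J : ModelWithCorners 𝕜 E' H'} [TopologicalSpace M] [ChartedSpace H' M]
    (hπ : ContMDiff 𝓘(𝕜, E) 𝓘(𝕜, H →L[ℂ] H) ∞ d.π) {w : M → G} {f : M → H} {s : Set M}
    (hw : ContMDiffOn J 𝓘(𝕜, E) ∞ w s) (hf : ContMDiffOn J 𝓘(𝕜, H) ∞ f s) :
    ContMDiffOn J 𝓘(𝕜, d.HB) ∞ (fun x => d.P (d.π (w x) (f x))) s :=
  (d.isBoundedBilinearMap_P_apply (𝕜 := 𝕜)).contDiff.contMDiff.comp_contMDiffOn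
    ((hπ.comp_contMDiffOn hw).prodMk_space hf)

/-- In the domain of a slice chart with section `σ` of the cosets, `[(z, f)]` has the coordinates
`Q z`, the coset coordinate, and `π_B(σ(Q z)⁻¹ z) f`. -/
theorem nonempty_bundleManifold [CompleteSpace E] [LieGroup 𝓘(𝕜, E) ∞ G]
    (hB : IsBanachLieSubgroup 𝕜 E d.B)
    (hπ : ContMDiff 𝓘(𝕜, E) 𝓘(𝕜, H →L[ℂ] H) ∞ d.π) : Nonempty (d.BundleManifold 𝕜 E) := by
  have := topologicalGroup_of_lieGroup 𝓘(𝕜, E) ∞ (G := G)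
  have : IsManifold 𝓘(𝕜, E) ∞ G := ContMDiffMul.toIsManifold
  obtain ⟨N, F, _, L, κ₁, h1, hκ₁⟩ := exists_isSliceChart_one hB
  refine nonempty_quotientManifold (N := N × d.HB) (F := F) d.isQuotientMap_toTotal.surjective ?_
  rintro ⟨g, f₀⟩
  obtain ⟨κ, hg, hκ⟩ := hκ₁.translate h1 g
  set Q : G → N := sliceCoord d.B L κ
  set σ : N → G := sliceSection L κ
  set W : Set G := sliceDomain d.B κ
  have hW : IsOpen W := isOpen_sliceDomain d.B κ
  -- the fibre coordinate
  set Φ : G × d.HB → d.HB := fun x => d.P (d.π ((σ (Q x.1))⁻¹ * x.1) x.2) with hΦ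
  have hB' : ∀ z ∈ W, (σ (Q z))⁻¹ * z ∈ d.B := fun z hz => by
    have := d.B.inv_mem (hκ.inv_mul_sliceSection_mem hz)
    simpa using this
  have hΦ' : ∀ x : G × d.HB, x.1 ∈ W → (Φ x : H) = d.π ((σ (Q x.1))⁻¹ * x.1) x.2 := fun x hx =>
    d.P_of_mem (d.map_mem _ (hB' _ hx) _ x.2.2)
  have hQ : ContMDiffOn (𝓘(𝕜, E).prod 𝓘(𝕜, d.HB)) 𝓘(𝕜, N) ∞ (fun x : G × d.HB => Q x.1)
      (Prod.fst ⁻¹' W) :=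
    hκ.contMDiffOn_sliceCoord.comp contMDiff_fst.contMDiffOn fun x hx => hx
  have hΦs : ContMDiffOn (𝓘(𝕜, E).prod 𝓘(𝕜, d.HB)) 𝓘(𝕜, d.HB) ∞ Φ (Prod.fst ⁻¹' W) := by
    refine contMDiffOn_P_π_apply hπ (ContMDiffOn.mul (ContMDiffOn.inv ?_)
      contMDiff_fst.contMDiffOn) ((d.contMDiff_coe_HB.comp contMDiff_snd).contMDiffOn)
    exact hκ.contMDiffOn_sliceSection.comp hQ fun x hx => hκ.sliceCoord_mem_sliceRange hx
  set Ω : Set d.Total := {ξ | d.proj ξ ∈ d.toBase '' κ.source}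
  have hmem : ∀ x : G × d.HB, d.toTotal x ∈ Ω ↔ x.1 ∈ W := by
    intro x
    change d.toBase x.1 ∈ d.toBase '' κ.source ↔ ∃ y ∈ κ.source, x.1⁻¹ * y ∈ d.B
    refine exists_congr fun y => and_congr_right fun _ => ?_
    rw [eq_comm, toBase_eq_toBase_iff]
  have hΩ : d.toTotal ⁻¹' Ω = Prod.fst ⁻¹' W := by
    ext x
    exact hmem x
  obtain ⟨e, he, hes, hez⟩ := exists_isQuotientChart (I := 𝓘(𝕜, E).prod 𝓘(𝕜, d.HB))
    (N := N × d.HB) d.isQuotientMap_toTotal (Ω := Ω)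
    (d.isQuotientMap_toTotal.isOpen_preimage.1 (hΩ ▸ hW.preimage continuous_fst))
    (U := Prod.fst ⁻¹' sliceRange L κ) ((isOpen_sliceRange L κ).preimage continuous_fst)
    (q := fun x => (Q x.1, Φ x)) (σ := fun y => (σ y.1, y.2))
    (hΩ ▸ hQ.prodMk_space hΦs)
    (by
      intro x y hx hxy
      obtain ⟨w, hw, h2, h3⟩ := d.toTotal_eq_toTotal_iff.1 hxy
      have hx' := (hmem x).1 hx
      have hy' : y.1 ∈ W := h2 ▸ mul_mem_sliceDomain hx' hw
      have hQxy : Q y.1 = Q x.1 := by rw [h2]; exact hκ.sliceCoord_mul hx' hw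
      refine Prod.ext hQxy.symm (Subtype.ext ?_)
      dsimp only
      rw [hΦ' x hx', hΦ' y hy', hQxy, h3, ← π_mul_apply, h2]
      congr 2
      group)
    (fun x hx => hκ.sliceCoord_mem_sliceRange ((hmem x).1 hx))
    (ContMDiffOn.prodMk (hκ.contMDiffOn_sliceSection.comp contDiff_fst.contMDiff.contMDiffOn
      fun y hy => hy) contDiff_snd.contMDiff.contMDiffOn)
    (fun y hy => (hmem _).2 (subset_sliceDomain (sliceSection_mem_source hy)))
    (by
      intro y hy
      have h2 : Q (σ y.1) = y.1 := hκ.sliceCoord_sliceSection hy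
      refine Prod.ext h2 (Subtype.ext ?_)
      dsimp only
      rw [hΦ' _ (subset_sliceDomain (sliceSection_mem_source hy))]
      dsimp only
      rw [h2]
      simp)
    (by
      intro x hx
      have hx' := (hmem x).1 hx
      refine (d.toTotal_eq_toTotal_iff.2 ⟨_, hκ.inv_mul_sliceSection_mem hx', ?_, ?_⟩).symm
      · simp [σ, Q]
      · dsimp only
        rw [hΦ' x hx', mul_inv_rev, _root_.inv_inv])
  set Ξ : E × d.HB → d.HB := fun v => d.P (d.π ((κ.symm v.1)⁻¹ * σ (L v.1).1) v.2) with hΞ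
  have hmul : ∀ w ∈ d.B, ∀ w' ∈ d.B, w * w' = 1 → ∀ f : d.HB,
      d.P (d.π w (d.P (d.π w' f) : d.HB)) = f := by
    intro w hw w' hw' hww f
    refine Subtype.ext ?_
    rw [d.P_of_mem (d.map_mem w' hw' _ f.2), ← π_mul_apply, hww, map_one]
    exact d.P_of_mem f.2
  have hQκ : ∀ z ∈ κ.source, (L (κ z)).1 = Q z := fun z hz => (hκ.sliceCoord_of_mem hz).symm
  have hκs : ∀ z ∈ κ.source, z⁻¹ * σ (Q z) ∈ d.B := fun z hz =>
    hκ.inv_mul_sliceSection_mem (subset_sliceDomain hz)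
  have hsm : ContMDiffOn (𝓘(𝕜, E).prod 𝓘(𝕜, d.HB)) (𝓘(𝕜, E).prod 𝓘(𝕜, d.HB)) ∞
      (fun x : G × d.HB => ((κ x.1, Φ x) : E × d.HB)) (κ.source ×ˢ univ) :=
    ((contMDiffOn_of_mem_maximalAtlas hκ.mem_maximalAtlas).comp contMDiff_fst.contMDiffOn
      fun x hx => hx.1).prodMk (hΦs.mono fun x hx => subset_sliceDomain hx.1)
  have hsm' : ContMDiffOn (𝓘(𝕜, E).prod 𝓘(𝕜, d.HB)) (𝓘(𝕜, E).prod 𝓘(𝕜, d.HB)) ∞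
      (fun v : E × d.HB => ((κ.symm v.1, Ξ v) : G × d.HB)) (κ.target ×ˢ univ) := by
    have e1 : ContMDiffOn (𝓘(𝕜, E).prod 𝓘(𝕜, d.HB)) 𝓘(𝕜, E) ∞
        (fun v : E × d.HB => κ.symm v.1) (κ.target ×ˢ univ) :=
      (contMDiffOn_symm_of_mem_maximalAtlas hκ.mem_maximalAtlas).comp contMDiff_fst.contMDiffOn
        fun x hx => hx.1
    refine e1.prodMk (contMDiffOn_P_π_apply hπ (e1.inv.mul ?_)
      ((d.contMDiff_coe_HB.comp contMDiff_snd).contMDiffOn))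
    refine hκ.contMDiffOn_sliceSection.comp (t := sliceRange L κ)
      (f := fun v : E × d.HB => (L v.1).1) ?_ fun v hv => hκ.map_target _ hv.1
    exact ((contDiff_fst.comp L.contDiff).contMDiff.comp contMDiff_fst).contMDiffOn
  -- the chart of `G × H_B` in which the quotient map is a linear projection
  let φ : OpenPartialHomeomorph (G × d.HB) (ModelProd E d.HB) :=
    { toFun := fun x => (κ x.1, Φ x)
      invFun := fun v => (κ.symm v.1, Ξ v)
      source := κ.source ×ˢ univ
      target := κ.target ×ˢ univ
      map_source' := fun x hx => ⟨κ.map_source hx.1, trivial⟩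
      map_target' := fun v hv => ⟨κ.map_target hv.1, trivial⟩
      left_inv' := by
        rintro ⟨z, f⟩ ⟨hz, -⟩
        refine Prod.ext (κ.left_inv hz) ?_
        simp only [hΞ, hΦ]
        rw [κ.left_inv hz, hQκ z hz]
        exact hmul _ (hκs z hz) _ (hB' z (subset_sliceDomain hz)) (by group) f
      right_inv' := by
        rintro ⟨v, f⟩ ⟨hv, -⟩
        refine Prod.ext (κ.right_inv hv) ?_
        have hz := κ.map_target hv
        have hv' : (L v).1 = Q (κ.symm v) := by rw [← hQκ _ hz, κ.right_inv hv]
        simp only [hΞ, hΦ]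
        rw [hv']
        exact hmul _ (hB' _ (subset_sliceDomain hz)) _ (hκs _ hz) (by group) f
      open_source := κ.open_source.prod isOpen_univ
      open_target := κ.open_target.prod isOpen_univ
      continuousOn_toFun := hsm.continuousOn
      continuousOn_invFun := hsm'.continuousOn }
  have hφ : φ ∈ IsManifold.maximalAtlas (𝓘(𝕜, E).prod 𝓘(𝕜, d.HB)) ∞ (G × d.HB) :=
    OpenPartialHomeomorph.mem_maximalAtlas_of_contMDiffOn _
      (by rw [chartedSpaceSelf_prod] at hsm; exact hsm)
      (by rw [chartedSpaceSelf_prod] at hsm'; exact hsm')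
  let L' : (E × d.HB) ≃L[𝕜] (N × d.HB) × F :=
    ((L.prodCongr (.refl 𝕜 d.HB)).trans (.prodAssoc 𝕜 N F d.HB)).trans
      (((ContinuousLinearEquiv.refl 𝕜 N).prodCongr (.prodComm 𝕜 F d.HB)).trans
        (ContinuousLinearEquiv.prodAssoc 𝕜 N d.HB F).symm)
  refine ⟨e, he, φ, hφ, L', ⟨hg, trivial⟩, fun x hx => ?_⟩
  have hx' : d.toTotal x ∈ Ω := (hmem x).2 (subset_sliceDomain hx.1)
  refine ⟨hes ▸ hx', ?_⟩
  rw [hez x hx']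
  have : Q x.1 = (L (κ x.1)).1 := hκ.sliceCoord_of_mem hx.1
  rw [this]
  rfl

end RepresentationPair

end

/-! ### Smooth sections -/

namespace RepresentationPair

universe uE uH uk uG

variable {𝕜 : Type uk} [RCLike 𝕜]
  {E : Type uE} [NormedAddCommGroup E] [NormedSpace 𝕜 E]
  {G : Type uG} [Group G] [StarMul G] [TopologicalSpace G] [ChartedSpace E G]
  {H : Type uH} [NormedAddCommGroup H] [InnerProductSpace ℂ H] [CompleteSpace H]
  {d : RepresentationPair G H}

/-- Smoothness of a section can be checked after lifting the base point to `G_A`. -/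
theorem isSmoothSection_of_comp_toBase [NormedSpace 𝕜 d.HB] (Z : d.BaseManifold 𝕜 E)
    (D : d.BundleManifold 𝕜 E) {σ : d.Sections}
    (h : letI := D.chartedSpace
      ContMDiff 𝓘(𝕜, E) 𝓘(𝕜, D.Model) ∞ fun u : G => (σ (d.toBase u)).val) :
    IsSmoothSection Z D σ := by
  let _ := Z.chartedSpace
  let _ := D.chartedSpace
  intro s
  obtain ⟨u, rfl⟩ := d.toBase_surjective s
  exact contMDiffAt_of_comp_submersion (f := fun s : d.Base => (σ s).val) (Z.submersion u) h

theorem isSmoothSection_γ [NormedAlgebra 𝕜 ℂ] [NormedSpace 𝕜 H] [IsScalarTower 𝕜 ℂ H]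
    [LieGroup 𝓘(𝕜, E) ∞ G] (hπ : ContMDiff 𝓘(𝕜, E) 𝓘(𝕜, H →L[ℂ] H) ∞ d.π)
    (Z : d.BaseManifold 𝕜 E) (D : d.BundleManifold 𝕜 E) (h : H) :
    IsSmoothSection Z D (d.γ h) := by
  refine isSmoothSection_of_comp_toBase Z D ?_
  let _ := D.chartedSpace
  have h1 : ContMDiff 𝓘(𝕜, E) 𝓘(𝕜, d.HB) ∞ fun u : G => d.P (d.π u⁻¹ h) :=
    contMDiffOn_univ.1 (contMDiffOn_P_π_apply hπ (contMDiff_id.inv).contMDiffOn contMDiffOn_const)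
  have h2 : ContMDiff (𝓘(𝕜, E).prod 𝓘(𝕜, d.HB)) 𝓘(𝕜, D.Model) ∞ d.toTotal := fun m =>
    (D.submersion m).contMDiffAt
  exact h2.comp (contMDiff_id.prodMk h1)

/-- The action of `v` on `D` is smooth, because it lifts to a left translation. -/
theorem isSmoothSection_sectionRep [NormedSpace 𝕜 d.HB] [LieGroup 𝓘(𝕜, E) ∞ G]
    (Z : d.BaseManifold 𝕜 E) (D : d.BundleManifold 𝕜 E) (v : G) {σ : d.Sections}
    (hσ : IsSmoothSection Z D σ) : IsSmoothSection Z D (d.sectionRep v σ) := by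
  refine isSmoothSection_of_comp_toBase Z D ?_
  let _ := Z.chartedSpace
  let _ := D.chartedSpace
  have h1 : ContMDiff 𝓘(𝕜, E) 𝓘(𝕜, Z.Model) ∞ d.toBase := fun u => (Z.submersion u).contMDiffAt
  have h2 : ContMDiff (𝓘(𝕜, E).prod 𝓘(𝕜, d.HB)) 𝓘(𝕜, D.Model) ∞ d.toTotal := fun m =>
    (D.submersion m).contMDiffAt
  have h3 : ContMDiff 𝓘(𝕜, D.Model) 𝓘(𝕜, D.Model) ∞ (d.act v) := by
    intro ξ
    obtain ⟨x, rfl⟩ := d.isQuotientMap_toTotal.surjective ξ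
    refine contMDiffAt_of_comp_submersion (D.submersion x) ?_
    exact h2.comp ((contMDiff_mul_left.comp contMDiff_fst).prodMk contMDiff_snd)
  have h4 : ContMDiff 𝓘(𝕜, E) 𝓘(𝕜, D.Model) ∞ fun u : G => (σ (d.toBase (v⁻¹ * u))).val :=
    (show ContMDiff 𝓘(𝕜, Z.Model) 𝓘(𝕜, D.Model) ∞ fun s : d.Base => (σ s).val from hσ).comp
      (h1.comp contMDiff_mul_left)
  exact h3.comp h4

end RepresentationPair

/-! ### The Hilbert space of the kernel -/

noncomputable section

namespace RepresentationPair

open scoped ComplexOrder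

variable {G H : Type*} [Group G] [StarMul G] [NormedAddCommGroup H]
  [InnerProductSpace ℂ H] [CompleteSpace H] (d : RepresentationPair G H)

/-- The evaluation `h ↦ (γ h)(s)` as a bounded operator. -/
def γEval (s : d.Base) : H →L[ℂ] d.Fiber s where
  toLinearMap := LinearMap.proj s ∘ₗ d.γ
  cont := by
    obtain ⟨u, rfl⟩ := d.toBase_surjective s
    refine (d.vecL (d.toBase u)).isometry.isEmbedding.continuous_iff.2 ?_
    have hc : Continuous fun h : H => d.π u (d.P (d.π u⁻¹ h) : d.HB) := by fun_prop
    exact hc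

variable {d}

/-- `K_η = γ(Θ(η))`, pointwise. -/
theorem kernel_eq_γ (s : d.Base) {t : d.Base} (η : d.Fiber t) : d.kernel s t η = d.γ η.vec s := by
  obtain ⟨u, rfl⟩ := d.toBase_surjective s
  exact Fiber.vec_injective (d.vec_kernelFun u η)

/-- The key identity: `γ` is adjoint to `Θ`. The involution on the base compensates for `π_A` not
being unitary: over `u^{-*} G_B`, the operator `π_A(u^{-*})` cancels against `π_A(u)`. -/
theorem pairing_γ {s t : d.Base} (hst : s = d.inv t) (h : H) (ξ : d.Fiber t) :
    pairing (d.γ h s) ξ = inner ℂ ξ.vec h := by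
  subst hst
  obtain ⟨u, rfl⟩ := d.toBase_surjective t
  obtain ⟨g, rfl⟩ := exists_fiberMk ξ
  change inner ℂ (d.π u g) (d.π (star u⁻¹) (d.P (d.π (star u⁻¹)⁻¹ h) : d.HB)) = inner ℂ (d.π u g) h
  rw [d.map_star, ContinuousLinearMap.adjoint_inner_right, π_inv_self, star_inv, _root_.inv_inv,
    ← sub_eq_zero, ← ContinuousLinearMap.adjoint_inner_right, ← d.map_star, ← inner_sub_right,
    ← neg_sub, inner_neg_right, neg_eq_zero]
  exact Submodule.inner_right_of_mem_orthogonal g.2 (Submodule.sub_starProjection_mem_orthogonal _)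

theorem pairing_kernel {s t : d.Base} (η : d.Fiber t) (ξ : d.Fiber (d.inv s)) :
    pairing (d.kernel s t η) ξ = inner ℂ ξ.vec η.vec := by
  rw [kernel_eq_γ, pairing_γ (inv_inv s).symm]

theorem conj_pairing {s t : d.Base} (η : d.Fiber t) (ξ : d.Fiber s) :
    conj (pairing η ξ) = pairing ξ η :=
  inner_conj_symm _ _

variable (d)

/-- Both double sums are `‖∑ j, Θ(η_j)‖ ^ 2`. -/
theorem isReproducingKernel_kernel : IsReproducingKernel d.kernel := by
  intro n t η
  have h1 : ∀ j l, pairing (d.kernel (t l) (d.inv (t j)) (η j)) (η l) =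
      inner ℂ (η l).vec (η j).vec := fun j l => pairing_kernel _ _
  have h2 : ∀ j l, pairing (η j) (d.kernel (t j) (d.inv (t l)) (η l)) =
      inner ℂ (η l).vec (η j).vec := fun j l => by
    rw [← conj_pairing, pairing_kernel, inner_conj_symm]
  simp only [h1, h2, true_and]
  have h3 : ∑ j, ∑ l, inner ℂ (η l).vec (η j).vec =
      inner ℂ (∑ l, (η l).vec) (∑ j, (η j).vec) := by
    rw [inner_sum]
    exact Finset.sum_congr rfl fun j _ => (sum_inner _ _ _).symm
  rw [h3, inner_self_eq_norm_sq_to_K]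
  norm_cast
  exact Complex.zero_le_real.2 (sq_nonneg _)

/-- The linear span of `π_A(G_A) H_B`. -/
abbrev orbitSpan : Submodule ℂ H := Submodule.span ℂ {x : H | ∃ u : G, ∃ f ∈ d.HB, x = d.π u f}

variable {d} in
theorem Fiber.vec_mem_orbitSpan {s : d.Base} (η : d.Fiber s) : η.vec ∈ d.orbitSpan := by
  obtain ⟨u, rfl⟩ := d.toBase_surjective s
  obtain ⟨f, rfl⟩ := exists_fiberMk η
  exact Submodule.subset_span ⟨u, f, f.2, rfl⟩

theorem ker_γ : LinearMap.ker d.γ = d.orbitSpanᗮ := by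
  ext h
  rw [LinearMap.mem_ker, Submodule.mem_orthogonal]
  constructor
  · intro hh x hx
    induction hx using Submodule.span_induction with
    | mem x hx =>
      obtain ⟨u, f, hf, rfl⟩ := hx
      have := pairing_γ rfl h (d.fiberMk u ⟨f, hf⟩)
      rw [hh, Pi.zero_apply, pairing, Fiber.vec_zero, inner_zero_right] at this
      exact this.symm
    | zero => simp
    | add x y _ _ hx hy => rw [inner_add_left, hx, hy, add_zero]
    | smul c x _ hx => rw [inner_smul_left, hx, mul_zero]
  · intro hh
    funext s
    obtain ⟨t, rfl⟩ := exists_inv_eq s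
    refine pairing_nondegenerate _ fun ξ => ?_
    rw [pairing_γ rfl]
    exact hh _ ξ.vec_mem_orbitSpan

theorem ker_γ_eq_orthogonal_closure : LinearMap.ker d.γ = d.orbitSpan.topologicalClosureᗮ := by
  rw [ker_γ, Submodule.orthogonal_closure]

variable {d} in
/-- `γ` is injective on the closed span of `π_A(G_A) H_B`, the orthogonal complement of its
kernel. -/
theorem γ_injOn {x y : H} (hx : x ∈ d.orbitSpan.topologicalClosure)
    (hy : y ∈ d.orbitSpan.topologicalClosure) (h : d.γ x = d.γ y) : x = y := by
  have h1 : x - y ∈ LinearMap.ker d.γ := by rw [LinearMap.mem_ker, map_sub, h, sub_self]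
  rw [ker_γ_eq_orthogonal_closure] at h1
  have h2 := Submodule.inner_right_of_mem_orthogonal (Submodule.sub_mem _ hx hy) h1
  exact sub_eq_zero.1 (inner_self_eq_zero.1 h2)

theorem sec_kernel {s : d.Base} (η : d.Fiber s) : d.kernel.sec η = d.γ η.vec :=
  funext fun z => kernel_eq_γ z η

theorem map_γ_orbitSpan : d.orbitSpan.map d.γ = d.kernel.span₀ := by
  rw [orbitSpan, Submodule.map_span, KernelFamily.span₀]
  congr 1
  ext σ
  constructor
  · rintro ⟨_, ⟨u, f, hf, rfl⟩, rfl⟩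
    exact ⟨⟨d.toBase u, d.fiberMk u ⟨f, hf⟩⟩, d.sec_kernel (d.fiberMk u ⟨f, hf⟩)⟩
  · rintro ⟨⟨s, η⟩, rfl⟩
    obtain ⟨u, rfl⟩ := d.toBase_surjective s
    obtain ⟨f, rfl⟩ := exists_fiberMk η
    exact ⟨d.π u f, ⟨u, f, f.2, rfl⟩, (d.sec_kernel (d.fiberMk u f)).symm⟩

/-- `γ` as a linear bijection of the span of `π_A(G_A) H_B` onto `H^K_0`. -/
def γEquiv : d.orbitSpan ≃ₗ[ℂ] d.kernel.span₀ :=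
  LinearEquiv.ofBijective
    ((d.γ ∘ₗ d.orbitSpan.subtype).codRestrict d.kernel.span₀ fun x => by
      rw [← map_γ_orbitSpan]
      exact Submodule.mem_map_of_mem x.2)
    ⟨fun x y hxy => Subtype.ext (γ_injOn (d.orbitSpan.le_topologicalClosure x.2)
        (d.orbitSpan.le_topologicalClosure y.2) (congrArg Subtype.val hxy)),
      fun F => by
        have hF : (F : d.Sections) ∈ d.orbitSpan.map d.γ := by
          rw [map_γ_orbitSpan]
          exact F.2
        obtain ⟨x, hx, hxF⟩ := Submodule.mem_map.1 hF
        exact ⟨⟨x, hx⟩, Subtype.ext hxF⟩⟩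

theorem γ_γEquiv_symm (F : d.kernel.span₀) : d.γ (d.γEquiv.symm F) = F :=
  congrArg Subtype.val (d.γEquiv.apply_symm_apply F)

variable {d} in
theorem γEquiv_symm_eq {F : d.kernel.span₀} {x : H} (hx : x ∈ d.orbitSpan) (h : d.γ x = F) :
    (d.γEquiv.symm F : H) = x :=
  γ_injOn (d.orbitSpan.le_topologicalClosure (d.γEquiv.symm F).2)
    (d.orbitSpan.le_topologicalClosure hx) ((d.γ_γEquiv_symm F).trans h.symm)

/-- The scalar product of `H^K_0` is carried over from `H_A` by `γ`. -/
theorem ip_eq_inner (F' F : d.kernel.span₀) :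
    KernelFamily.ip F' F = inner ℂ (d.γEquiv.symm F' : H) (d.γEquiv.symm F : H) := by
  obtain ⟨a, ha⟩ := KernelFamily.exists_comb F'
  have h1 : (d.γEquiv.symm F' : H) = a.sum fun y c => c • y.2.vec := by
    refine γEquiv_symm_eq (Submodule.sum_mem _ fun y _ =>
      Submodule.smul_mem _ _ y.2.vec_mem_orbitSpan) ?_
    rw [← ha, KernelFamily.comb, Finsupp.linearCombination_apply, map_finsuppSum]
    exact Finsupp.sum_congr fun y _ => by rw [map_smul, sec_kernel]
  rw [d.isReproducingKernel_kernel.ip_eq ha, h1, KernelFamily.formAux, Finsupp.sum, Finsupp.sum,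
    sum_inner]
  refine Finset.sum_congr rfl fun y _ => ?_
  rw [inner_smul_left, ← d.γ_γEquiv_symm F, pairing_γ rfl]

/-- The inverse of `γ` on `H^K_0`, as a linear isometry into `H_A`. -/
def preIsometry : PreHilbert d.kernel d.isReproducingKernel_kernel →ₗᵢ[ℂ] H :=
  LinearMap.isometryOfInner
    (E := PreHilbert d.kernel d.isReproducingKernel_kernel)
    { toFun := fun F => (d.γEquiv.symm F : H)
      map_add' := fun F F' => congrArg Subtype.val (d.γEquiv.symm.map_add F F')
      map_smul' := fun c F => congrArg Subtype.val (d.γEquiv.symm.map_smul c F) }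
    fun F' F => (d.ip_eq_inner F' F).symm

end RepresentationPair

end

/-! ### The isometry `W` and the factorization of the kernel -/

noncomputable section

namespace RepresentationPair

variable {G H : Type*} [Group G] [StarMul G] [NormedAddCommGroup H]
  [InnerProductSpace ℂ H] [CompleteSpace H] (d : RepresentationPair G H)

/-- The Hilbert space `H^K` of the kernel `K`. -/
abbrev KernelSpace : Type _ := KernelHilbert d.kernel d.isReproducingKernel_kernel

/-- The isometry `W : H^K → H_A` with `W(K_η) = Θ(η)`, the continuous extension of the inverse of
`γ` on `H^K_0`. -/
def W : d.KernelSpace →ₗᵢ[ℂ] H where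
  toLinearMap := (d.preIsometry.toContinuousLinearMap.extend
    (UniformSpace.Completion.toComplL (𝕜 := ℂ)
      (E := PreHilbert d.kernel d.isReproducingKernel_kernel))).toLinearMap
  norm_map' x := by
    induction x using UniformSpace.Completion.induction_on with
    | hp => exact isClosed_eq (ContinuousLinearMap.continuous _).norm continuous_norm
    | ih F =>
      refine (congrArg norm (ContinuousLinearMap.extend_eq _
        UniformSpace.Completion.denseRange_coe
        (UniformSpace.Completion.isUniformInducing_coe _) F)).trans ?_
      rw [UniformSpace.Completion.norm_coe]
      exact d.preIsometry.norm_map F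

theorem W_toKernelHilbert (F : d.kernel.span₀) :
    d.W (toKernelHilbert d.isReproducingKernel_kernel F) = d.γEquiv.symm F :=
  ContinuousLinearMap.extend_eq _ UniformSpace.Completion.denseRange_coe
    (UniformSpace.Completion.isUniformInducing_coe _) _

theorem W_khat {s : d.Base} (η : d.Fiber s) :
    d.W (khat d.isReproducingKernel_kernel η) = η.vec :=
  (d.W_toKernelHilbert _).trans (γEquiv_symm_eq η.vec_mem_orbitSpan (d.sec_kernel η).symm)

/-- The range of the isometry `W` is closed, and it contains the vectors `Θ(η) = W(K_η)`. -/
theorem range_W : (LinearMap.range d.W.toLinearMap : Submodule ℂ H) =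
    d.orbitSpan.topologicalClosure := by
  refine le_antisymm ?_ (Submodule.topologicalClosure_minimal _ ?_ ?_)
  · rintro _ ⟨x, rfl⟩
    induction x using UniformSpace.Completion.induction_on with
    | hp => exact d.orbitSpan.isClosed_topologicalClosure.preimage d.W.continuous
    | ih F =>
      have hF : d.W F = d.γEquiv.symm F := d.W_toKernelHilbert F
      exact hF ▸ d.orbitSpan.le_topologicalClosure (d.γEquiv.symm F).2
  · refine Submodule.span_le.2 ?_
    rintro _ ⟨u, f, hf, rfl⟩
    exact ⟨_, d.W_khat (d.fiberMk u ⟨f, hf⟩)⟩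
  · exact d.W.isometry.isClosedEmbedding.isClosed_range

theorem W_mem (x : d.KernelSpace) : d.W x ∈ d.orbitSpan.topologicalClosure := by
  rw [← range_W]
  exact ⟨x, rfl⟩

theorem isCanonicalInclusion_γ_comp_W :
    IsCanonicalInclusion d.isReproducingKernel_kernel (d.γ ∘ₗ d.W.toLinearMap) where
  apply_coe F := by
    change d.γ (d.W _) = _
    rw [W_toKernelHilbert, γ_γEquiv_symm]
  injective x y hxy := d.W.injective (γ_injOn (d.W_mem x) (d.W_mem y) hxy)
  continuous_eval s := (d.γEval s).continuous.comp d.W.continuous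

/-- By the orthogonal decomposition of `H_A`: `γ` vanishes on the complement of the range of `W`. -/
theorem range_γ : LinearMap.range d.γ = LinearMap.range (d.γ ∘ₗ d.W.toLinearMap) := by
  refine le_antisymm ?_ (LinearMap.range_comp_le_range _ _)
  rintro _ ⟨h, rfl⟩
  obtain ⟨y, hy, z, hz, rfl⟩ := d.orbitSpan.topologicalClosure.exists_add_mem_mem_orthogonal h
  rw [← range_W] at hy
  obtain ⟨x, rfl⟩ := hy
  rw [← ker_γ_eq_orthogonal_closure, LinearMap.mem_ker] at hz
  exact ⟨x, by rw [map_add, hz, add_zero]; rfl⟩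

/-- The bounded operator `η ↦ K_η` on the fibre `D_t`. -/
def khatL (t : d.Base) : d.Fiber t →L[ℂ] d.KernelSpace :=
  LinearMap.mkContinuous
    { toFun := fun η => khat d.isReproducingKernel_kernel η
      map_add' := fun η η' => d.W.injective (by simp [W_khat])
      map_smul' := fun c η => d.W.injective (by simp [W_khat]) } 1 fun η => by
    rw [one_mul, ← d.W.norm_map]
    exact (congrArg norm (d.W_khat η)).le

@[simp] theorem khatL_apply {t : d.Base} (η : d.Fiber t) :
    d.khatL t η = khat d.isReproducingKernel_kernel η := rfl

theorem isMinusStar_khatL (t : d.Base) :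
    IsMinusStar ((d.γEval t).comp d.W.toContinuousLinearMap) (d.khatL (d.inv t)) := by
  intro F y
  change pairing (d.γ (d.W F) t) y = _
  rw [pairing_γ (inv_inv t).symm, khatL_apply, ← d.W.inner_map_map, W_khat]

theorem kernel_eq_comp_khatL (s t : d.Base) :
    d.kernel s t = ((d.γEval s).comp d.W.toContinuousLinearMap).comp (d.khatL t) := by
  ext1 η
  change _ = d.γ (d.W (khat _ η)) s
  rw [W_khat, kernel_eq_γ]

theorem γ_π (v : G) (h : H) : d.γ (d.π v h) = d.sectionRep v (d.γ h) := by
  funext t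
  obtain ⟨u, rfl⟩ := d.toBase_surjective t
  refine Fiber.vec_injective ?_
  change _ = (d.translate v (d.γ h) (d.toBase u)).vec
  rw [vec_translate]
  change d.π u (d.P (d.π u⁻¹ (d.π v h)) : d.HB) =
    d.π v (d.π (v⁻¹ * u) (d.P (d.π (v⁻¹ * u)⁻¹ h) : d.HB))
  rw [← π_mul_apply, ← π_mul_apply, mul_inv_cancel_left, mul_inv_rev, _root_.inv_inv]

end RepresentationPair

end

theorem theorem5p2
    -- a real (`𝕜 = ℝ`) or complex (`𝕜 = ℂ`) involutive Banach-Lie group `G = G_A`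
    {𝕜 : Type*} [RCLike 𝕜] [NormedAlgebra 𝕜 ℂ]
    {E : Type*} [NormedAddCommGroup E] [NormedSpace 𝕜 E] [CompleteSpace E]
    [NormedSpace ℝ E] [IsScalarTower ℝ 𝕜 E]
    {G : Type*} [Group G] [StarMul G] [TopologicalSpace G] [ChartedSpace E G]
    [LieGroup 𝓘(𝕜, E) ∞ G]
    (hstar : ContMDiff 𝓘(ℝ, E) 𝓘(ℝ, E) ∞ (star : G → G))
    -- the complex Hilbert space `H = H_A`
    {H : Type*} [NormedAddCommGroup H] [InnerProductSpace ℂ H] [CompleteSpace H]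
    [NormedSpace 𝕜 H] [IsScalarTower 𝕜 ℂ H]
    -- the data `(π_A, π_B, P)`
    (d : RepresentationPair G H)
    (hB : IsBanachLieSubgroup 𝕜 E d.B)
    (hcont : Continuous d.π)
    (hhol : (RCLike.I : 𝕜) ≠ 0 → MDifferentiable 𝓘(𝕜, E) 𝓘(𝕜, H →L[ℂ] H) d.π) :
    -- `G_A / G_B` and `D` are quotient manifolds
    Nonempty (d.BaseManifold 𝕜 E) ∧ Nonempty (d.BundleManifold 𝕜 E) ∧
    -- `γ` takes values in the smooth sections
    (∀ (Z : d.BaseManifold 𝕜 E) (D : d.BundleManifold 𝕜 E) (h : H),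
      RepresentationPair.IsSmoothSection Z D (d.γ h)) ∧
    -- the explicit formula for `γ`
    (∀ (h : H) (u : G), d.γ h (d.toBase u) = d.fiberMk u (d.P (d.π u⁻¹ h))) ∧
    -- the kernel of `γ`
    LinearMap.ker d.γ = (Submodule.span ℂ {x : H | ∃ u : G, ∃ f ∈ d.HB, x = d.π u f})ᗮ ∧
    -- the explicit formula for `K`
    (∀ (u v : G) (f : d.HB), d.kernel (d.toBase u) (d.toBase v) (d.fiberMk v f) =
      d.fiberMk u (d.P (d.π u⁻¹ (d.π v f)))) ∧
    (∃ hK : RepresentationPair.IsReproducingKernel d.kernel,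
      -- the isometry `W : H^K → H_A`, `K_η ↦ Θ(η)`
      ∃ W : RepresentationPair.KernelHilbert d.kernel hK →ₗᵢ[ℂ] H,
        (∀ (s : d.Base) (η : d.Fiber s), W (RepresentationPair.khat hK η) = d.Θ η.val) ∧
        (LinearMap.range W.toLinearMap : Submodule ℂ H) =
          (Submodule.span ℂ {x : H | ∃ u : G, ∃ f ∈ d.HB, x = d.π u f}).topologicalClosure ∧
        -- `γ ∘ W` is the canonical inclusion `ι` of `H^K`, and `γ` maps `H_A` onto `H^K`
        RepresentationPair.IsCanonicalInclusion hK (d.γ ∘ₗ W.toLinearMap) ∧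
        LinearMap.range d.γ = LinearMap.range (d.γ ∘ₗ W.toLinearMap) ∧
        -- `γ ∘ Θ = K̂`
        (∀ (s : d.Base) (η : d.Fiber s),
          d.γ (d.Θ η.val) = (d.γ ∘ₗ W.toLinearMap) (RepresentationPair.khat hK η)) ∧
        -- the evaluations `ev_t = ι(·)(t)` are bounded and `K(s, t^{-*}) = ev_s ∘ (ev_t)^{-*}`
        (∃ ev : ∀ t : d.Base, RepresentationPair.KernelHilbert d.kernel hK →L[ℂ] d.Fiber t,
          (∀ t F, ev t F = (d.γ ∘ₗ W.toLinearMap) F t) ∧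
          ∀ t, ∃ S : d.Fiber (d.inv t) →L[ℂ] RepresentationPair.KernelHilbert d.kernel hK,
            RepresentationPair.IsMinusStar (ev t) S ∧
            ∀ s, d.kernel s (d.inv t) = (ev s).comp S)) ∧
    -- `γ` intertwines `π_A` and the natural representation on the smooth sections
    (∀ (Z : d.BaseManifold 𝕜 E) (D : d.BundleManifold 𝕜 E) (v : G) (σ : d.Sections),
      RepresentationPair.IsSmoothSection Z D σ →
        RepresentationPair.IsSmoothSection Z D (d.sectionRep v σ)) ∧
    (∀ (v : G) (h : H), d.γ (d.π v h) = d.sectionRep v (d.γ h)) := by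
  have hπ := d.contMDiff_π hcont hhol
  exact ⟨d.nonempty_baseManifold hB, RepresentationPair.nonempty_bundleManifold hB hπ,
    RepresentationPair.isSmoothSection_γ hπ, d.γ_apply, d.ker_γ, d.kernel_apply,
    ⟨d.isReproducingKernel_kernel, d.W, fun s η => d.W_khat η, d.range_W,
      d.isCanonicalInclusion_γ_comp_W, d.range_γ, fun s η => congrArg d.γ (d.W_khat η).symm,
      fun t => (d.γEval t).comp d.W.toContinuousLinearMap, fun t F => rfl,
      fun t => ⟨d.khatL (d.inv t), d.isMinusStar_khatL t, fun s => d.kernel_eq_comp_khatL s _⟩⟩,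
    fun Z D v σ hσ => RepresentationPair.isSmoothSection_sectionRep Z D v hσ, d.γ_π⟩
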